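/- Let \(G=(V,E)\) be a finite simple graph that is a forest. A simplicial complex \((\Delta,X)\) is a finite set \(X\) with a family \(\Delta\) of subsets of \(X\) closed under taking subsets; the void complex \(\emptyset\) and the irrelevant complex \(\{\emptyset\}\) are allowed, and elements of \(X\) need not be vertices. Its Alexander dual is \((\Delta^*,X)\) with \(\Delta^*=\{F\subseteq X: X\setminus F\notin\Delta\}\). For \(a\in X\), the deletion \(\operatorname{dl}_a(\Delta)=\{\sigma\in\Delta: a\notin\sigma\}\) and the link \(\operatorname{lk}_a(\Delta)=\{\sigma\in\Delta: a\notin\sigma,\ \sigma\cup\{a\}\in\Delta\}\) are complexes on \(X\setminus\{a\}\). The complex \(\Delta\) is a cone if there is \(x\in X\) with \(\sigma\cup\{x\}\in\Delta\) for all \(\sigma\in\Delta\). Recursively, \((\Delta,X)\) is a strong combinatorial grape if it has at most one vertex, or if there is \(a\in X\) such that at least one of \(\operatorname{lk}_a(\Delta)\), \(\operatorname{dl}_a(\Delta)\) is a cone and both are strong combinatorial grapes. If \(\tau\subset\sigma\in\Delta\), \(|\tau|=|\sigma|-1\) (\(\tau=\emptyset\) allowed) and \(\sigma\) is the only face properly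 containing \(\tau\), then removing \(\sigma\) and \(\tau\) is an elementary collapse, and its inverse is an elementary expansion. Two complexes are simple-homotopy equivalent if they are related, up to isomorphism, by a finite sequence of elementary collapses and expansions (which may introduce new vertices). For \(n\ge 0\), \(\partial\beta_n=S^0*\cdots*S^0\) (\(n\) times) is the boundary of the \(n\)-dimensional cross-polytope; \(\partial\beta_0=\{\emptyset\}\). Let \(\gamma(G)\), \(i(G)\), \(\alpha_0(G)\) be the minimum cardinality of, respectively, a dominating set, an independent dominating set, and a vertex cover of \(G\). Let - \(\operatorname{Ind}(G)\), on the ground set \(V\), have as faces the independent sets of \(G\); - \(\operatorname{Dom}(G)\), on the ground set \(V\), have as faces the \(F\) such that \(V\setminus F\) is a dominating set; - \(\operatorname{EC}(G)\), on the ground set \(E\), have as faces the \(F\) such that every vertex of \(G\) lies in an edge of \(E\setminus F\); - \(\operatorname{ED}(G)\), on the ground set \(E\), have as faces the \(F\) such that every edge of \(G\) meets an edge of \(E\setminus F\) (possibly itself). Then \(\operatorname{Ind}(G)^*\), \(\operatorname{Dom}(G)^*\), \(\operatorname{EC}(G)^*\) and \(\operatorname{ED}(G)^*\) are all strong combinatorial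 grapes. Moreover: 1. \(\operatorname{Ind}(G)^*\) is simple-homotopy equivalent to either the void complex or \(\partial\beta_{|V|-i(G)-1}\), and in the latter case \(i(G)=\gamma(G)\); 2. if \(V\neq\emptyset\), then \(\operatorname{Dom}(G)^*\) is simple-homotopy equivalent to \(\partial\beta_{|V|-\alpha_0(G)-1}\); 3. if \(E\neq\emptyset\), then \(\operatorname{EC}(G)^*\) is simple-homotopy equivalent to either the void complex or \(\partial\beta_{|V|-i(G)-1}\), and in the latter case \(i(G)=\gamma(G)\); 4. if \(E\neq\emptyset\), then \(\operatorname{ED}(G)^*\) is simple-homotopy equivalent to \(\partial\beta_{\alpha_0(G)-1}\). Whenever a complex \(\partial\beta_m\) occurs here as the simple-homotopy type, it is part of the claim that \(m\ge 0\). -/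

import Mathlib

/-- A finite simplicial complex `(Δ, X)`: a finite ground set `X` and a family of subsets of `X`
closed under taking subsets. The empty family (the void complex) and `{∅}` (the irrelevant
complex) are both allowed, and elements of `X` need not be vertices. -/
structure FinComplex (α : Type*) where
  /-- the ground set `X` -/
  ground : Finset α
  /-- the faces, the empty face included if there is any face -/
  faces : Finset (Finset α)
  subset_ground : ∀ F ∈ faces, F ⊆ ground
  down_closed : ∀ F ∈ faces, ∀ F' ⊆ F, F' ∈ faces

namespace FinComplex

section Basic

variable {α : Type*} [DecidableEq α]

/-- The void complex on the ground set `X`: it has no faces. -/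
def void (X : Finset α) : FinComplex α where
  ground := X
  faces := ∅
  subset_ground := by simp
  down_closed := by simp

/-- The vertices: the elements `x` of the ground set such that `{x}` is a face. -/
def vertices (Δ : FinComplex α) : Finset α :=
  Δ.ground.filter fun x => {x} ∈ Δ.faces

/-- The deletion of `a`, on the ground set `X \ {a}`. -/
def deletion (Δ : FinComplex α) (a : α) : FinComplex α where
  ground := Δ.ground.erase a
  faces := Δ.faces.filter fun F => a ∉ F
  subset_ground := by
    intro F hF
    rw [Finset.mem_filter] at hF
    exact Finset.subset_erase.2 ⟨Δ.subset_ground F hF.1, hF.2⟩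
  down_closed := by
    intro F hF F' hF'
    rw [Finset.mem_filter] at hF ⊢
    exact ⟨Δ.down_closed F hF.1 F' hF', fun h => hF.2 (hF' h)⟩

/-- The link of `a`, on the ground set `X \ {a}`. -/
def link (Δ : FinComplex α) (a : α) : FinComplex α where
  ground := Δ.ground.erase a
  faces := Δ.faces.filter fun F => a ∉ F ∧ insert a F ∈ Δ.faces
  subset_ground := by
    intro F hF
    rw [Finset.mem_filter] at hF
    exact Finset.subset_erase.2 ⟨Δ.subset_ground F hF.1, hF.2.1⟩
  down_closed := by
    intro F hF F' hF'
    rw [Finset.mem_filter] at hF ⊢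
    exact ⟨Δ.down_closed F hF.1 F' hF', fun h => hF.2.1 (hF' h),
      Δ.down_closed _ hF.2.2 _ (Finset.insert_subset_insert a hF')⟩

/-- The Alexander dual `Δ* = {F ⊆ X : X \ F ∉ Δ}`, on the same ground set. -/
def alexanderDual (Δ : FinComplex α) : FinComplex α where
  ground := Δ.ground
  faces := Δ.ground.powerset.filter fun F => Δ.ground \ F ∉ Δ.faces
  subset_ground := by
    intro F hF
    exact Finset.mem_powerset.1 (Finset.mem_filter.1 hF).1
  down_closed := by
    intro F hF F' hF'
    rw [Finset.mem_filter, Finset.mem_powerset] at hF ⊢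
    exact ⟨hF'.trans hF.1, fun h => hF.2
      (Δ.down_closed _ h _ (Finset.sdiff_subset_sdiff (Finset.Subset.refl _) hF'))⟩

/-- `Δ` is a cone: `Δ = Γ * {∅, {x}}` for some apex `x` in the ground set and some complex `Γ`
with no face containing `x` (namely `Γ = dl_x Δ`). The cone on the void complex is void. -/
def IsCone (Δ : FinComplex α) : Prop :=
  ∃ x ∈ Δ.ground, ∀ F ∈ Δ.faces, insert x F ∈ Δ.faces

/-- Strong combinatorial grapes (the recursion ends because the ground set shrinks). -/
inductive IsStrongGrape : FinComplex α → Prop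
  | base (Δ : FinComplex α) (h : Δ.vertices.card ≤ 1) : IsStrongGrape Δ
  | step (Δ : FinComplex α) (a : α) (ha : a ∈ Δ.ground)
      (hcone : (Δ.link a).IsCone ∨ (Δ.deletion a).IsCone)
      (hdl : IsStrongGrape (Δ.deletion a)) (hlk : IsStrongGrape (Δ.link a)) : IsStrongGrape Δ

/-- `L` is obtained from the family of faces `K` by an elementary collapse: one removes a face `σ`
and a subset `τ` of `σ` of cardinality `|σ| - 1` such that `σ` is the only face of `K` properly
containing `τ` (which makes `σ` maximal). Here `τ` may be empty. -/
def ElementaryCollapse (K L : Finset (Finset α)) : Prop :=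
  ∃ σ ∈ K, ∃ τ : Finset α, τ ⊆ σ ∧ τ.card + 1 = σ.card ∧
    (∀ ρ ∈ K, τ ⊂ ρ → ρ = σ) ∧ L = K \ {σ, τ}

end Basic

/-- One move between simplicial complexes with vertices in `ℕ`: an elementary collapse, or an
injective renaming of the vertices (complexes are considered up to isomorphism). Both moves lead
from a complex to a complex. -/
def SimpleMove (K L : Finset (Finset ℕ)) : Prop :=
  IsLowerSet (K : Set (Finset ℕ)) ∧
    (ElementaryCollapse K L ∨ ∃ e : ℕ ↪ ℕ, L = K.image (Finset.map e))

/-- Simple-homotopy equivalence: after naming the vertices of both complexes by natural numbers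
(so that expansions always find new vertices), they are connected by a finite sequence of
elementary collapses, elementary expansions, and renamings of vertices. The ground sets play no
role. -/
def SimpleHomotopyEquiv {α β : Type*} (Δ : FinComplex α) (Γ : FinComplex β) : Prop :=
  ∃ (f : α → ℕ) (g : β → ℕ), Set.InjOn f Δ.ground ∧ Set.InjOn g Γ.ground ∧
    Relation.EqvGen SimpleMove (Δ.faces.image (Finset.image f)) (Γ.faces.image (Finset.image g))

/-- The boundary `∂β_n = S⁰ * ⋯ * S⁰` (`n` times) of the `n`-dimensional cross-polytope, on the
`2n` vertices `(i, ±)`: the faces are the sets of vertices without antipodal pair. For `n = 0` it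
is the irrelevant complex `{∅}`. -/
def crossPolytopeBoundary (n : ℕ) : FinComplex (Fin n × Bool) where
  ground := Finset.univ
  faces := Finset.univ.filter fun F => ∀ i : Fin n, ¬ ((i, true) ∈ F ∧ (i, false) ∈ F)
  subset_ground := fun F _ => Finset.subset_univ F
  down_closed := by
    intro F hF F' hF'
    rw [Finset.mem_filter] at hF ⊢
    exact ⟨Finset.mem_univ _, fun i h => hF.2 i ⟨hF' h.1, hF' h.2⟩⟩

end FinComplex

namespace SimpleGraph

variable {V : Type*}

/-- `D` is a dominating set: `N[D] = V`. -/
def IsDominatingSet (G : SimpleGraph V) (D : Finset V) : Prop :=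
  ∀ v, ∃ d ∈ D, d = v ∨ G.Adj d v

instance [Fintype V] [DecidableEq V] (G : SimpleGraph V) [DecidableRel G.Adj] (D : Finset V) :
    Decidable (G.IsDominatingSet D) :=
  inferInstanceAs (Decidable (∀ v, ∃ d ∈ D, d = v ∨ G.Adj d v))

/-- The domination number `γ(G)`. -/
noncomputable def dominationNum (G : SimpleGraph V) : ℕ :=
  sInf {n | ∃ D : Finset V, G.IsDominatingSet D ∧ D.card = n}

/-- The independent domination number `i(G)`. -/
noncomputable def indepDominationNum (G : SimpleGraph V) : ℕ :=
  sInf {n | ∃ D : Finset V, G.IsIndepSet (D : Set V) ∧ G.IsDominatingSet D ∧ D.card = n}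

variable [Fintype V] [DecidableEq V] (G : SimpleGraph V) [DecidableRel G.Adj]

/-- The independence complex `Ind(G)`, on the ground set `V`. -/
def indepComplex : FinComplex V where
  ground := Finset.univ
  faces := Finset.univ.filter fun F => G.IsIndepSet (F : Set V)
  subset_ground := fun F _ => Finset.subset_univ F
  down_closed := by
    intro F hF F' hF'
    rw [Finset.mem_filter] at hF ⊢
    exact ⟨Finset.mem_univ _, hF.2.mono (Finset.coe_subset.2 hF')⟩

/-- The dominance complex `Dom(G)`, on the ground set `V`: `F` is a face if `V \ F` is
dominating. -/
def dominanceComplex : FinComplex V where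
  ground := Finset.univ
  faces := Finset.univ.filter fun F => G.IsDominatingSet (Finset.univ \ F)
  subset_ground := fun F _ => Finset.subset_univ F
  down_closed := by
    intro F hF F' hF'
    rw [Finset.mem_filter] at hF ⊢
    refine ⟨Finset.mem_univ _, fun v => ?_⟩
    obtain ⟨d, hd, h⟩ := hF.2 v
    exact ⟨d, Finset.sdiff_subset_sdiff (Finset.Subset.refl _) hF' hd, h⟩

/-- The edge covering complex `EC(G)`, on the ground set `E`: `F` is a face if `E \ F` is an
edge cover. -/
def edgeCoverComplex : FinComplex (Sym2 V) where
  ground := G.edgeFinset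
  faces := G.edgeFinset.powerset.filter fun F => ∀ v : V, ∃ e ∈ G.edgeFinset \ F, v ∈ e
  subset_ground := fun F hF => Finset.mem_powerset.1 (Finset.mem_filter.1 hF).1
  down_closed := by
    intro F hF F' hF'
    rw [Finset.mem_filter, Finset.mem_powerset] at hF ⊢
    refine ⟨hF'.trans hF.1, fun v => ?_⟩
    obtain ⟨e, he, h⟩ := hF.2 v
    exact ⟨e, Finset.sdiff_subset_sdiff (Finset.Subset.refl _) hF' he, h⟩

/-- The edge dominance complex `ED(G)`, on the ground set `E`: `F` is a face if every edge meets
some edge of `E \ F` (possibly itself). -/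
def edgeDominanceComplex : FinComplex (Sym2 V) where
  ground := G.edgeFinset
  faces := G.edgeFinset.powerset.filter fun F =>
    ∀ e ∈ G.edgeFinset, ∃ e' ∈ G.edgeFinset \ F, ∃ v : V, v ∈ e' ∧ v ∈ e
  subset_ground := fun F hF => Finset.mem_powerset.1 (Finset.mem_filter.1 hF).1
  down_closed := by
    intro F hF F' hF'
    rw [Finset.mem_filter, Finset.mem_powerset] at hF ⊢
    refine ⟨hF'.trans hF.1, fun e he => ?_⟩
    obtain ⟨e', he', h⟩ := hF.2 e he
    exact ⟨e', Finset.sdiff_subset_sdiff (Finset.Subset.refl _) hF' he', h⟩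

end SimpleGraph

/-!
All four Alexander duals are complexes of non-transversals: there is a hypergraph on the ground set
such that the faces are the sets of points that miss some hyperedge. For `Ind(G)*` the hyperedges
are the edges of `G`, for `Dom(G)*` the closed neighbourhoods, for `EC(G)*` the stars of the
vertices, and for `ED(G)*` the closed neighbourhoods in the line graph (`nonTransversal` and the
four lemmas `SimpleGraph.*_alexanderDual`).

Such a complex is a cone as soon as some point lies in no minimal hyperedge. Suppose instead that
all hyperedges through a point `x` contain one of them, `S`. The other points of `S` can be
deleted one by one, since their links are cones with apex `x`; then the deletion of `x` is a full
simplex, and the complex is the suspension of the link of `x`, whose hypergraph has lost the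
points of `S` and the hyperedges through `x` (`FinComplex.HasOutcome.step`). In a forest rooted by
a depth function, a deepest vertex or edge always provides such an `x`, or the apex of a cone. So
the process ends either with a contractible complex or, when `k` steps exhaust all points and
hyperedges, with `∂β_{k-1}`, and along the way it proves that the complex is a strong
combinatorial grape.

It remains to compute `k`. For closed neighbourhoods each step removes a closed neighbourhood that
is a clique, so the process never fails, and the chosen points form an independent set of the size
of a clique cover; this gives the vertex cover number, through its complement for `Dom` and
through matchings for `ED` (`SimpleGraph.exists_hasOutcome_of_simplicial`). For `Ind` and `EC` the
process produces a minimal vertex cover with `k` elements, whose complement is an independent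
dominating set, and a packing of `|V| - k` disjoint closed neighbourhoods, so that `i(G) = γ(G) =
|V| - k` (`SimpleGraph.IsDepth.hasOutcome_edges`, `SimpleGraph.IsDepth.hasOutcome_stars`).

The two simple-homotopy types are told apart by the parity of the number of faces, which collapses
preserve: a sphere `∂β_n` has `3 ^ n` faces.
-/

/-! ### Simple-homotopy moves on families of subsets of `ℕ` -/

namespace FinComplex

/-- Removing a whole family of pairs `{F, F ∪ {x}}`, for `F` in a family `M` which is closed
upwards in `K` up to adding `x`, is a sequence of elementary collapses: the pairs are removed in
the order of decreasing cardinality. -/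
theorem eqvGen_sdiff_pairs (x : ℕ) (M : Finset (Finset ℕ)) :
    ∀ K : Finset (Finset ℕ), IsLowerSet (K : Set (Finset ℕ)) →
      (∀ F ∈ M, x ∉ F ∧ insert x F ∈ K) →
      (∀ F ∈ M, ∀ ρ ∈ K, F ⊆ ρ → ρ.erase x ∈ M) →
      Relation.EqvGen SimpleMove K (K \ (M ∪ M.image (insert x))) := by
  induction M using Finset.strongInduction with
  | H M ih =>
    intro K hK hM hup
    rcases M.eq_empty_or_nonempty with rfl | hne
    · simpa using Relation.EqvGen.refl K
    · obtain ⟨F, hF, hmax⟩ := M.exists_max_image Finset.card hne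
      obtain ⟨hxF, hxFK⟩ := hM F hF
      have hFK : F ∈ K := hK (Finset.subset_insert x F) hxFK
      have key : ∀ ρ ∈ K, F ⊆ ρ → ρ = F ∨ ρ = insert x F := by
        intro ρ hρ hFρ
        have h1 := hup F hF ρ hρ hFρ
        have h2 : F ⊆ ρ.erase x := Finset.subset_erase.2 ⟨hFρ, hxF⟩
        have h3 := Finset.eq_of_subset_of_card_le h2 (hmax _ h1)
        by_cases hx : x ∈ ρ
        · right
          rw [h3, Finset.insert_erase hx]
        · left
          rw [h3, Finset.erase_eq_of_notMem hx]
      have hne' : insert x F ≠ F := fun h => hxF (h ▸ Finset.mem_insert_self x F)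
      have hcol : ElementaryCollapse K (K \ {insert x F, F}) := by
        refine ⟨insert x F, hxFK, F, Finset.subset_insert x F,
          (Finset.card_insert_of_notMem hxF).symm, ?_, rfl⟩
        intro ρ hρ hlt
        rcases key ρ hρ hlt.subset with h | h
        · exact absurd h.symm hlt.ne
        · exact h
      have hK' : IsLowerSet ((K \ {insert x F, F} : Finset (Finset ℕ)) : Set (Finset ℕ)) := by
        intro ρ ρ' hle hρ
        simp only [Finset.coe_sdiff, Set.mem_sdiff, Finset.mem_coe, Finset.mem_insert,
          Finset.mem_singleton, not_or] at hρ ⊢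
        refine ⟨hK hle hρ.1, ?_, ?_⟩
        · rintro rfl
          rcases key ρ hρ.1 ((Finset.subset_insert x F).trans hle) with h | h
          · exact hρ.2.2 h
          · exact hρ.2.1 h
        · rintro rfl
          rcases key ρ hρ.1 hle with h | h
          · exact hρ.2.2 h
          · exact hρ.2.1 h
      have hrec := ih (M.erase F) (Finset.erase_ssubset hF) (K \ {insert x F, F}) hK' ?_ ?_
      · refine Relation.EqvGen.trans _ _ _ (Relation.EqvGen.rel _ _ ⟨hK, Or.inl hcol⟩) ?_
        convert hrec using 1
        ext ρ
        simp only [Finset.mem_sdiff, Finset.mem_union, Finset.mem_image, Finset.mem_insert,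
          Finset.mem_singleton, Finset.mem_erase]
        constructor
        · rintro ⟨h1, h2⟩
          refine ⟨⟨h1, ?_⟩, ?_⟩
          · rintro (rfl | rfl)
            · exact h2 (Or.inr ⟨F, hF, rfl⟩)
            · exact h2 (Or.inl hF)
          · rintro (h | ⟨F', h, h'⟩)
            · exact h2 (Or.inl h.2)
            · exact h2 (Or.inr ⟨F', h.2, h'⟩)
        · rintro ⟨⟨h1, h2⟩, h3⟩
          refine ⟨h1, ?_⟩
          rintro (h | ⟨F', h, h'⟩)
          · exact h3 (Or.inl ⟨fun hh => h2 (Or.inr hh), h⟩)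
          · exact h3 (Or.inr ⟨F', ⟨fun hh => h2 (Or.inl (by rw [← h', hh])), h⟩, h'⟩)
      · intro F' hF'
        rw [Finset.mem_erase] at hF'
        obtain ⟨h1, h2⟩ := hM F' hF'.2
        refine ⟨h1, ?_⟩
        simp only [Finset.mem_sdiff, Finset.mem_insert, Finset.mem_singleton, not_or]
        refine ⟨h2, ?_, ?_⟩
        · intro h
          apply hF'.1
          rw [← Finset.erase_insert h1, h, Finset.erase_insert hxF]
        · intro h
          exact hxF (h ▸ Finset.mem_insert_self x F')
      · intro F' hF' ρ hρ hsub
        rw [Finset.mem_erase] at hF' ⊢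
        simp only [Finset.mem_sdiff, Finset.mem_insert, Finset.mem_singleton, not_or] at hρ
        refine ⟨?_, hup F' hF'.2 ρ hρ.1 hsub⟩
        intro h
        by_cases hx : x ∈ ρ
        · exact hρ.2.1 (by rw [← h, Finset.insert_erase hx])
        · exact hρ.2.2 (by rw [← h, Finset.erase_eq_of_notMem hx])

/-- A cone is simple-homotopy equivalent to the void complex. -/
theorem eqvGen_empty_of_cone {K : Finset (Finset ℕ)} (hK : IsLowerSet (K : Set (Finset ℕ)))
    {x : ℕ} (hx : ∀ F ∈ K, insert x F ∈ K) : Relation.EqvGen SimpleMove K ∅ := by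
  have h := eqvGen_sdiff_pairs x (K.filter fun F => x ∉ F) K hK ?_ ?_
  · convert h using 1
    ext F
    simp only [Finset.notMem_empty, Finset.mem_sdiff, Finset.mem_union, Finset.mem_filter,
      Finset.mem_image, false_iff, not_and, not_not]
    intro hF
    by_cases hxF : x ∈ F
    · exact Or.inr ⟨F.erase x, ⟨hK (Finset.erase_subset x F) hF, Finset.notMem_erase x F⟩,
        Finset.insert_erase hxF⟩
    · exact Or.inl ⟨hF, hxF⟩
  · intro F hF
    rw [Finset.mem_filter] at hF
    exact ⟨hF.2, hx F hF.1⟩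
  · intro F _ ρ hρ _
    exact Finset.mem_filter.2 ⟨hK (Finset.erase_subset x ρ) hρ, Finset.notMem_erase x ρ⟩

/-- If the link of `a` is a cone, a complex collapses to the deletion of `a`. -/
theorem eqvGen_deletion_of_link_cone {K : Finset (Finset ℕ)}
    (hK : IsLowerSet (K : Set (Finset ℕ))) {a x : ℕ} (hax : x ≠ a)
    (hx : ∀ F ∈ K, a ∈ F → insert x F ∈ K) :
    Relation.EqvGen SimpleMove K (K.filter fun F => a ∉ F) := by
  have h := eqvGen_sdiff_pairs x (K.filter fun F => a ∈ F ∧ x ∉ F) K hK ?_ ?_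
  · convert h using 1
    ext F
    simp only [Finset.mem_sdiff, Finset.mem_union, Finset.mem_filter, Finset.mem_image]
    refine and_congr_right fun hF => ?_
    constructor
    · rintro haF (⟨_, h, _⟩ | ⟨F', ⟨_, h, _⟩, rfl⟩)
      · exact haF h
      · exact haF (Finset.mem_insert_of_mem h)
    · intro h haF
      apply h
      by_cases hxF : x ∈ F
      · exact Or.inr ⟨F.erase x, ⟨hK (Finset.erase_subset x F) hF,
          Finset.mem_erase.2 ⟨hax.symm, haF⟩, Finset.notMem_erase x F⟩, Finset.insert_erase hxF⟩
      · exact Or.inl ⟨hF, haF, hxF⟩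
  · intro F hF
    rw [Finset.mem_filter] at hF
    exact ⟨hF.2.2, hx F hF.1 hF.2.1⟩
  · intro F hF ρ hρ hsub
    rw [Finset.mem_filter] at hF ⊢
    exact ⟨hK (Finset.erase_subset x ρ) hρ, Finset.mem_erase.2 ⟨hax.symm, hsub hF.2.1⟩,
      Finset.notMem_erase x ρ⟩

/-- Renaming of vertices by `n ↦ n + 2`, which frees the names `0` and `1`. -/
def shiftTwo : ℕ ↪ ℕ := ⟨fun n => n + 2, fun _ _ h => Nat.add_right_cancel h⟩

@[simp]
theorem shiftTwo_apply (n : ℕ) : shiftTwo n = n + 2 := rfl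

/-- The suspension of a family of subsets of `ℕ`: the old vertices are shifted by two, and `0` and
`1` are the two suspension points. -/
def suspension (K : Finset (Finset ℕ)) : Finset (Finset ℕ) :=
  K.image (Finset.map shiftTwo) ∪
    (K.image (fun F => insert 0 (F.map shiftTwo)) ∪ K.image (fun F => insert 1 (F.map shiftTwo)))

theorem zero_notMem_map_shiftTwo (F : Finset ℕ) : 0 ∉ F.map shiftTwo := by
  simp

theorem one_notMem_map_shiftTwo (F : Finset ℕ) : 1 ∉ F.map shiftTwo := by
  simp

/-- The set of old vertices contained in a set of vertices of a suspension. -/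
noncomputable def unshiftTwo (F : Finset ℕ) : Finset ℕ :=
  F.preimage shiftTwo shiftTwo.injective.injOn

theorem mem_unshiftTwo {F : Finset ℕ} {n : ℕ} : n ∈ unshiftTwo F ↔ n + 2 ∈ F := by
  simp [unshiftTwo]

theorem mem_suspension {K : Finset (Finset ℕ)} {F : Finset ℕ} :
    F ∈ suspension K ↔ unshiftTwo F ∈ K ∧ ¬ (0 ∈ F ∧ 1 ∈ F) := by
  simp only [suspension, Finset.mem_union, Finset.mem_image]
  constructor
  · rintro (⟨F, hF, rfl⟩ | ⟨F, hF, rfl⟩ | ⟨F, hF, rfl⟩)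
    all_goals
      refine ⟨?_, by simp⟩
      convert hF
      ext n
      simp [mem_unshiftTwo]
  · rintro ⟨h, h'⟩
    by_cases h0 : 0 ∈ F
    · refine Or.inr (Or.inl ⟨_, h, ?_⟩)
      ext n
      rcases n with _ | _ | n <;> simp_all [mem_unshiftTwo]
    · by_cases h1 : 1 ∈ F
      · refine Or.inr (Or.inr ⟨_, h, ?_⟩)
        ext n
        rcases n with _ | _ | n <;> simp_all [mem_unshiftTwo]
      · refine Or.inl ⟨_, h, ?_⟩
        ext n
        rcases n with _ | _ | n <;> simp_all [mem_unshiftTwo]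

theorem isLowerSet_suspension {K : Finset (Finset ℕ)} (hK : IsLowerSet (K : Set (Finset ℕ))) :
    IsLowerSet (suspension K : Set (Finset ℕ)) := by
  intro F F' hle hF
  rw [Finset.mem_coe, mem_suspension] at hF ⊢
  refine ⟨hK (fun n hn => ?_) hF.1, fun h => hF.2 ⟨hle h.1, hle h.2⟩⟩
  exact mem_unshiftTwo.2 (hle (mem_unshiftTwo.1 hn))

theorem card_suspension (K : Finset (Finset ℕ)) : (suspension K).card = 3 * K.card := by
  have hinj : ∀ F F' : Finset ℕ, F.map shiftTwo = F'.map shiftTwo → F = F' := fun F F' h =>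
    Finset.map_injective _ h
  have i0 : Function.Injective fun F : Finset ℕ => insert 0 (F.map shiftTwo) := fun F F' h => by
    apply hinj
    rw [← Finset.erase_insert (zero_notMem_map_shiftTwo F),
      ← Finset.erase_insert (zero_notMem_map_shiftTwo F')]
    exact congrArg (fun s => Finset.erase s 0) h
  have i1 : Function.Injective fun F : Finset ℕ => insert 1 (F.map shiftTwo) := fun F F' h => by
    apply hinj
    rw [← Finset.erase_insert (one_notMem_map_shiftTwo F),
      ← Finset.erase_insert (one_notMem_map_shiftTwo F')]
    exact congrArg (fun s => Finset.erase s 1) h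
  rw [suspension, Finset.card_union_of_disjoint, Finset.card_union_of_disjoint,
    Finset.card_image_of_injective _ hinj, Finset.card_image_of_injective _ i0,
    Finset.card_image_of_injective _ i1]
  · ring
  · rw [Finset.disjoint_left]
    simp only [Finset.mem_image]
    rintro _ ⟨F, -, rfl⟩ ⟨F', -, h⟩
    have : 0 ∈ insert 1 (F'.map shiftTwo) := h ▸ Finset.mem_insert_self _ _
    simp at this
  · rw [Finset.disjoint_left]
    simp only [Finset.mem_image, Finset.mem_union]
    rintro _ ⟨F, -, rfl⟩ (⟨F', -, h⟩ | ⟨F', -, h⟩)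
    · exact zero_notMem_map_shiftTwo F (h ▸ Finset.mem_insert_self _ _)
    · exact one_notMem_map_shiftTwo F (h ▸ Finset.mem_insert_self _ _)

/-- Suspension respects moves: the suspension of a collapse of `σ` and `τ` is three collapses, whose
faces are those of the suspension that restrict to `σ` or `τ` on the old vertices. -/
theorem eqvGen_suspension_of_move {K L : Finset (Finset ℕ)} (h : SimpleMove K L) :
    Relation.EqvGen SimpleMove (suspension K) (suspension L) := by
  obtain ⟨hK, ⟨σ, hσ, τ, hτσ, hcard, hmax, rfl⟩ | ⟨e, rfl⟩⟩ := h
  · -- `σ = τ ∪ {x}`, so all three collapses are removals of pairs differing by `x + 2`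
    obtain ⟨x, hxτ, rfl⟩ : ∃ x, x ∉ τ ∧ insert x τ = σ := by
      obtain ⟨x, hx⟩ := Finset.card_eq_one.1
        (show (σ \ τ).card = 1 by rw [Finset.card_sdiff_of_subset hτσ]; omega)
      have hx' : x ∈ σ \ τ := hx ▸ Finset.mem_singleton_self x
      refine ⟨x, (Finset.mem_sdiff.1 hx').2, ?_⟩
      rw [Finset.insert_eq, ← hx, Finset.sdiff_union_of_subset hτσ]
    have key : ∀ ρ ∈ K, τ ⊆ ρ → ρ.erase x = τ := by
      intro ρ hρ hs
      rcases hs.eq_or_ssubset with rfl | hs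
      · exact Finset.erase_eq_of_notMem hxτ
      · rw [hmax ρ hρ hs, Finset.erase_insert hxτ]
    have hM : ∀ F, F ∈ ((suspension K).filter fun F => unshiftTwo F = τ) ↔
        unshiftTwo F = τ ∧ ¬ (0 ∈ F ∧ 1 ∈ F) := by
      intro F
      rw [Finset.mem_filter, mem_suspension]
      constructor
      · rintro ⟨⟨-, h⟩, h'⟩
        exact ⟨h', h⟩
      · rintro ⟨rfl, h⟩
        exact ⟨⟨hK (Finset.subset_insert _ _) hσ, h⟩, rfl⟩
    have hins : ∀ F : Finset ℕ, unshiftTwo (insert (x + 2) F) = insert x (unshiftTwo F) := by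
      intro F
      ext n
      simp [mem_unshiftTwo]
    have hers : ∀ F : Finset ℕ, unshiftTwo (F.erase (x + 2)) = (unshiftTwo F).erase x := by
      intro F
      ext n
      simp [mem_unshiftTwo]
    have h := eqvGen_sdiff_pairs (x + 2) ((suspension K).filter fun F => unshiftTwo F = τ)
      (suspension K) (isLowerSet_suspension hK) ?_ ?_
    · convert h using 1
      ext F
      simp only [Finset.mem_sdiff, Finset.mem_union, Finset.mem_image, hM, mem_suspension,
        Finset.mem_insert, Finset.mem_singleton]
      constructor
      · rintro ⟨⟨h1, h2⟩, h3⟩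
        refine ⟨⟨h1, h3⟩, ?_⟩
        rintro (h | ⟨F', h, rfl⟩)
        · exact h2 (Or.inr h.1)
        · exact h2 (Or.inl (by rw [hins, h.1]))
      · rintro ⟨⟨h1, h2⟩, h3⟩
        refine ⟨⟨h1, ?_⟩, h2⟩
        rintro (h | h)
        · refine h3 (Or.inr ⟨F.erase (x + 2), ⟨?_, ?_⟩, ?_⟩)
          · rw [hers, h, Finset.erase_insert hxτ]
          · exact fun hh => h2 ⟨Finset.mem_of_mem_erase hh.1, Finset.mem_of_mem_erase hh.2⟩
          · exact Finset.insert_erase (mem_unshiftTwo.1 (h ▸ Finset.mem_insert_self x τ))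
        · exact h3 (Or.inl ⟨h, h2⟩)
    · intro F hF
      rw [hM] at hF
      refine ⟨fun h => hxτ (hF.1 ▸ mem_unshiftTwo.2 h), ?_⟩
      rw [mem_suspension, hins, hF.1]
      refine ⟨hσ, ?_⟩
      simpa using hF.2
    · intro F hF ρ hρ hsub
      rw [hM] at hF ⊢
      rw [mem_suspension] at hρ
      refine ⟨?_, fun hh => hρ.2 ⟨Finset.mem_of_mem_erase hh.1, Finset.mem_of_mem_erase hh.2⟩⟩
      rw [hers]
      apply key _ hρ.1
      rw [← hF.1]
      exact fun n hn => mem_unshiftTwo.2 (hsub (mem_unshiftTwo.1 hn))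
  · -- a renaming of the old vertices extends by the identity on the suspension points
    let e' : ℕ ↪ ℕ := ⟨fun n => if n < 2 then n else e (n - 2) + 2, by
      intro m n h
      dsimp only at h
      split_ifs at h with h1 h2 h2
      · exact h
      · omega
      · omega
      · have := e.injective (Nat.add_right_cancel h)
        omega⟩
    have he : ∀ F : Finset ℕ, (F.map shiftTwo).map e' = (F.map e).map shiftTwo := by
      intro F
      rw [Finset.map_map, Finset.map_map]
      congr 1
    have e0 : e' 0 = 0 := rfl
    have e1 : e' 1 = 1 := rfl
    refine Relation.EqvGen.rel _ _ ⟨isLowerSet_suspension hK, Or.inr ⟨e', ?_⟩⟩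
    simp only [suspension, Finset.image_union, Finset.image_image, Function.comp_def,
      Finset.map_insert, he, e0, e1]

theorem eqvGen_suspension {K L : Finset (Finset ℕ)} (h : Relation.EqvGen SimpleMove K L) :
    Relation.EqvGen SimpleMove (suspension K) (suspension L) := by
  induction h with
  | rel K L h => exact eqvGen_suspension_of_move h
  | refl K => exact Relation.EqvGen.refl _
  | symm K L _ ih => exact Relation.EqvGen.symm _ _ ih
  | trans K L M _ _ ih₁ ih₂ => exact Relation.EqvGen.trans _ _ _ ih₁ ih₂

/-- If the deletion of `a` is a cone, then the complex is simple-homotopy equivalent to the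
suspension of the link of `a`. Coning the deletion off at a new vertex `b` gives a complex that
collapses to the given one, as the link of `b` is a cone, and that also collapses to the suspension
of the link of `a` with suspension points `a` and `b`. -/
theorem eqvGen_suspension_link_of_deletion_cone {K : Finset (Finset ℕ)}
    (hK : IsLowerSet (K : Set (Finset ℕ))) {a x : ℕ} (hax : x ≠ a)
    (hx : ∀ F ∈ K, a ∉ F → insert x F ∈ K) :
    Relation.EqvGen SimpleMove K (suspension (K.filter fun F => a ∉ F ∧ insert a F ∈ K)) := by
  obtain ⟨b, hb⟩ : ∃ b, b ∉ insert a (insert x (K.biUnion id)) := Infinite.exists_notMem_finset _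
  simp only [Finset.mem_insert, Finset.mem_biUnion, id, not_or, not_exists, not_and] at hb
  obtain ⟨hba, hbx, hb⟩ := hb
  set D := K.filter fun F => a ∉ F with hD
  set Kb := K ∪ D.image (insert b) with hKb
  have hmem : ∀ F, F ∈ Kb ↔ F ∈ K ∨ (b ∈ F ∧ a ∉ F ∧ F.erase b ∈ K) := by
    intro F
    simp only [hKb, hD, Finset.mem_union, Finset.mem_image, Finset.mem_filter]
    refine or_congr_right ⟨?_, ?_⟩
    · rintro ⟨F, ⟨h1, h2⟩, rfl⟩
      refine ⟨Finset.mem_insert_self _ _, ?_, ?_⟩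
      · simpa [Finset.mem_insert, Ne.symm hba] using h2
      · rwa [Finset.erase_insert (hb F h1)]
    · rintro ⟨h1, h2, h3⟩
      exact ⟨F.erase b, ⟨h3, fun h => h2 (Finset.mem_of_mem_erase h)⟩, Finset.insert_erase h1⟩
  have hKb_lower : IsLowerSet (Kb : Set (Finset ℕ)) := by
    intro F F' hle hF
    rw [Finset.mem_coe, hmem] at hF ⊢
    rcases hF with h | ⟨h1, h2, h3⟩
    · exact Or.inl (hK hle h)
    · by_cases hbF : b ∈ F'
      · exact Or.inr ⟨hbF, fun h => h2 (hle h), hK (Finset.erase_subset_erase b hle) h3⟩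
      · exact Or.inl (hK (Finset.subset_erase.2 ⟨hle, hbF⟩) h3)
  have h1 : Relation.EqvGen SimpleMove Kb K := by
    have h := eqvGen_deletion_of_link_cone hKb_lower (a := b) (x := x) (Ne.symm hbx) ?_
    · convert h using 1
      ext F
      rw [Finset.mem_filter, hmem]
      constructor
      · exact fun h => ⟨Or.inl h, hb F h⟩
      · rintro ⟨h | h, h'⟩
        · exact h
        · exact absurd h.1 h'
    · intro F hF hbF
      rw [hmem] at hF ⊢
      rcases hF with h | ⟨-, h2, h3⟩
      · exact absurd hbF (hb F h)
      · refine Or.inr ⟨Finset.mem_insert_of_mem hbF, ?_, ?_⟩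
        · simp [h2, Ne.symm hax]
        · rw [Finset.erase_insert_of_ne (Ne.symm hbx)]
          exact hx _ h3 fun h => h2 (Finset.mem_of_mem_erase h)
  set Lk := K.filter fun F => a ∉ F ∧ insert a F ∈ K with hLk
  set M := K.filter fun F => a ∉ F ∧ insert a F ∉ K with hM
  have h2 : Relation.EqvGen SimpleMove Kb (Kb \ (M ∪ M.image (insert b))) := by
    refine eqvGen_sdiff_pairs b M Kb hKb_lower ?_ ?_
    · intro F hF
      rw [hM, Finset.mem_filter] at hF
      refine ⟨hb F hF.1, (hmem _).2 (Or.inr ⟨Finset.mem_insert_self _ _, ?_, ?_⟩)⟩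
      · simp [hF.2.1, Ne.symm hba]
      · rw [Finset.erase_insert (hb F hF.1)]
        exact hF.1
    · intro F hF ρ hρ hsub
      rw [hM, Finset.mem_filter] at hF ⊢
      have hbF := hb F hF.1
      have hup : ∀ ρ ∈ K, F ⊆ ρ → a ∉ ρ ∧ insert a ρ ∉ K := by
        intro ρ hρ hs
        refine ⟨fun ha => hF.2.2 (hK (Finset.insert_subset ha hs) hρ), fun h => hF.2.2 ?_⟩
        exact hK (Finset.insert_subset_insert a hs) h
      have hs' : F ⊆ ρ.erase b := Finset.subset_erase.2 ⟨hsub, hbF⟩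
      have : ρ.erase b ∈ K := by
        rcases (hmem ρ).1 hρ with h | h
        · exact hK (Finset.erase_subset b ρ) h
        · exact h.2.2
      exact ⟨this, hup _ this hs'⟩
  let e : ℕ ↪ ℕ := ⟨fun n => if n = a then 0 else if n = b then 1 else n + 2, by
    intro m n h
    dsimp only at h
    split_ifs at h <;> omega⟩
  have ea : e a = 0 := if_pos rfl
  have eb : e b = 1 := by
    change (if b = a then 0 else if b = b then 1 else b + 2) = 1
    rw [if_neg hba, if_pos rfl]
  have he : ∀ F ∈ Lk, F.map e = F.map shiftTwo := by
    intro F hF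
    rw [hLk, Finset.mem_filter] at hF
    rw [Finset.map_eq_image, Finset.map_eq_image]
    refine Finset.image_congr fun n hn => ?_
    have hna : n ≠ a := fun h => hF.2.1 (h ▸ hn)
    have hnb : n ≠ b := fun h => hb F hF.1 (h ▸ hn)
    change (if n = a then 0 else if n = b then 1 else n + 2) = n + 2
    rw [if_neg hna, if_neg hnb]
  have h3 : Kb \ (M ∪ M.image (insert b)) = Lk ∪ (Lk.image (insert a) ∪ Lk.image (insert b)) := by
    ext F
    simp only [Finset.mem_sdiff, hmem, Finset.mem_union, Finset.mem_image, hM, hLk,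
      Finset.mem_filter]
    constructor
    · rintro ⟨h | ⟨hbF, haF, hF⟩, hn⟩
      · by_cases haF : a ∈ F
        · refine Or.inr (Or.inl ⟨F.erase a, ⟨hK (Finset.erase_subset a F) h,
            Finset.notMem_erase a F, ?_⟩, Finset.insert_erase haF⟩)
          rwa [Finset.insert_erase haF]
        · left
          refine ⟨h, haF, ?_⟩
          by_contra hc
          exact hn (Or.inl ⟨h, haF, hc⟩)
      · refine Or.inr (Or.inr ⟨F.erase b, ⟨hF, fun h => haF (Finset.mem_of_mem_erase h), ?_⟩,
          Finset.insert_erase hbF⟩)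
        by_contra hc
        exact hn (Or.inr ⟨F.erase b, ⟨hF, fun h => haF (Finset.mem_of_mem_erase h), hc⟩,
          Finset.insert_erase hbF⟩)
    · rintro (⟨h1, h2, h3⟩ | ⟨F, ⟨h1, h2, h3⟩, rfl⟩ | ⟨F, ⟨h1, h2, h3⟩, rfl⟩)
      · refine ⟨Or.inl h1, ?_⟩
        rintro (h | ⟨F', -, rfl⟩)
        · exact h.2.2 h3
        · exact hb _ h1 (Finset.mem_insert_self _ _)
      · refine ⟨Or.inl h3, ?_⟩
        rintro (h | ⟨F', -, h⟩)
        · exact h.2.1 (Finset.mem_insert_self _ _)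
        · exact hb _ h3 (h ▸ Finset.mem_insert_self _ _)
      · refine ⟨Or.inr ⟨Finset.mem_insert_self _ _, ?_, ?_⟩, ?_⟩
        · simp [h2, Ne.symm hba]
        · rwa [Finset.erase_insert (hb F h1)]
        · rintro (h | ⟨F', h', h⟩)
          · exact hb _ h.1 (Finset.mem_insert_self _ _)
          · apply h'.2.2
            rwa [← Finset.erase_insert (hb F' h'.1), h, Finset.erase_insert (hb F h1)]
  have h4 : SimpleMove (Kb \ (M ∪ M.image (insert b))) (suspension Lk) := by
    refine ⟨?_, Or.inr ⟨e, ?_⟩⟩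
    · rw [h3]
      intro F F' hle hF
      simp only [Finset.mem_coe, Finset.mem_union, Finset.mem_image] at hF ⊢
      have hLkl : ∀ F ∈ Lk, ∀ F' ⊆ F, F' ∈ Lk := by
        intro F hF F' hs
        rw [hLk, Finset.mem_filter] at hF ⊢
        exact ⟨hK hs hF.1, fun h => hF.2.1 (hs h), hK (Finset.insert_subset_insert a hs) hF.2.2⟩
      have aux : ∀ c F, F ∈ Lk → F' ⊆ insert c F → F' ∈ Lk ∨ ∃ G ∈ Lk, insert c G = F' := by
        intro c F hF hs
        by_cases hc : c ∈ F'
        · exact Or.inr ⟨F'.erase c, hLkl F hF _ (Finset.subset_insert_iff.1 hs),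
            Finset.insert_erase hc⟩
        · exact Or.inl (hLkl F hF _ ((Finset.subset_insert_iff_of_notMem hc).1 hs))
      rcases hF with hF | ⟨F, hF, rfl⟩ | ⟨F, hF, rfl⟩
      · exact Or.inl (hLkl F hF F' hle)
      · rcases aux a F hF hle with h | h
        · exact Or.inl h
        · exact Or.inr (Or.inl h)
      · rcases aux b F hF hle with h | h
        · exact Or.inl h
        · exact Or.inr (Or.inr h)
    · rw [h3, Finset.image_union, Finset.image_union, Finset.image_image, Finset.image_image]
      refine congrArg₂ _ ?_ (congrArg₂ _ ?_ ?_)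
      · exact Finset.image_congr fun F hF => (he F hF).symm
      · refine Finset.image_congr fun F hF => ?_
        simp only [Function.comp_apply, Finset.map_insert, he F hF, ea]
      · refine Finset.image_congr fun F hF => ?_
        simp only [Function.comp_apply, Finset.map_insert, he F hF, eb]
  exact Relation.EqvGen.trans _ _ _ (Relation.EqvGen.symm _ _ h1)
    (Relation.EqvGen.trans _ _ _ h2 (Relation.EqvGen.rel _ _ h4))

/-- The parity of the number of faces is a simple-homotopy invariant. -/
theorem card_mod_two_of_eqvGen {K L : Finset (Finset ℕ)} (h : Relation.EqvGen SimpleMove K L) :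
    K.card % 2 = L.card % 2 := by
  induction h with
  | rel K L h =>
    obtain ⟨hK, ⟨σ, hσ, τ, hτσ, hcard, -, rfl⟩ | ⟨e, rfl⟩⟩ := h
    · have hne : σ ≠ τ := by
        rintro rfl
        omega
      have hsub : ({σ, τ} : Finset (Finset ℕ)) ⊆ K :=
        Finset.insert_subset hσ (Finset.singleton_subset_iff.2 (hK hτσ hσ))
      have h1 := Finset.card_sdiff_add_card_eq_card hsub
      rw [Finset.card_pair hne] at h1
      omega
    · rw [Finset.card_image_of_injective _ (Finset.map_injective e)]
  | refl K => rfl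
  | symm K L _ ih => exact ih.symm
  | trans K L M _ _ ih₁ ih₂ => exact ih₁.trans ih₂

end FinComplex

/-! ### Cross-polytopes as iterated suspensions -/

namespace FinComplex

/-- The boundary of the `n`-dimensional cross-polytope as an `n`-fold suspension of `{∅}`. -/
def sphereFaces : ℕ → Finset (Finset ℕ)
  | 0 => {∅}
  | n + 1 => suspension (sphereFaces n)

theorem card_sphereFaces (n : ℕ) : (sphereFaces n).card = 3 ^ n := by
  induction n with
  | zero => rfl
  | succ n ih => rw [sphereFaces, card_suspension, ih, pow_succ, mul_comm]

theorem mem_sphereFaces (n : ℕ) : ∀ F : Finset ℕ,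
    F ∈ sphereFaces n ↔ (∀ m ∈ F, m < 2 * n) ∧ ∀ i, ¬ (2 * i ∈ F ∧ 2 * i + 1 ∈ F) := by
  induction n with
  | zero =>
    intro F
    simp only [sphereFaces, Finset.mem_singleton, mul_zero, Nat.not_lt_zero]
    constructor
    · rintro rfl
      simp
    · exact fun h => Finset.eq_empty_of_forall_notMem h.1
  | succ n ih =>
    intro F
    rw [sphereFaces, mem_suspension, ih]
    simp only [mem_unshiftTwo]
    constructor
    · rintro ⟨⟨h1, h2⟩, h3⟩
      refine ⟨?_, ?_⟩
      · intro m hm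
        rcases m with _ | _ | m
        · omega
        · omega
        · have := h1 m hm
          omega
      · intro i
        rcases i with _ | i
        · exact h3
        · exact h2 i
    · rintro ⟨h1, h2⟩
      refine ⟨⟨fun m hm => ?_, fun i => h2 (i + 1)⟩, h2 0⟩
      have := h1 _ hm
      omega

/-- The standard names `2i` and `2i + 1` for the vertices `(i, -)` and `(i, +)`. -/
def crossPolytopeLabel (n : ℕ) (v : Fin n × Bool) : ℕ := 2 * v.1 + v.2.toNat

theorem crossPolytopeLabel_injective (n : ℕ) : Function.Injective (crossPolytopeLabel n) := by
  rintro ⟨i, b⟩ ⟨j, c⟩ h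
  cases b <;> cases c <;> simp [crossPolytopeLabel, Fin.ext_iff] at h ⊢ <;> omega

theorem image_crossPolytopeBoundary (n : ℕ) :
    (crossPolytopeBoundary n).faces.image (Finset.image (crossPolytopeLabel n)) =
      sphereFaces n := by
  have hinj := crossPolytopeLabel_injective n
  have ht : ∀ i : Fin n, crossPolytopeLabel n (i, true) = 2 * (i : ℕ) + 1 := fun i => rfl
  have hf : ∀ i : Fin n, crossPolytopeLabel n (i, false) = 2 * (i : ℕ) := fun i => rfl
  ext F
  rw [mem_sphereFaces, Finset.mem_image]
  constructor
  · rintro ⟨F, hF, rfl⟩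
    replace hF := (Finset.mem_filter.1 hF).2
    have hlt : ∀ m ∈ F.image (crossPolytopeLabel n), m < 2 * n := by
      intro m hm
      obtain ⟨⟨i, b⟩, -, rfl⟩ := Finset.mem_image.1 hm
      have := i.2
      cases b <;> simp only [ht, hf] <;> omega
    refine ⟨hlt, ?_⟩
    rintro i ⟨h1, h2⟩
    have hi := hlt _ h1
    have hi' : i < n := by omega
    refine hF ⟨i, hi'⟩ ⟨?_, ?_⟩
    · rwa [← hinj.mem_finset_image, ht]
    · rwa [← hinj.mem_finset_image, hf]
  · rintro ⟨h1, h2⟩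
    refine ⟨Finset.univ.filter fun v => crossPolytopeLabel n v ∈ F, ?_, ?_⟩
    · refine Finset.mem_filter.2 ⟨Finset.mem_univ _, fun i h => h2 i ?_⟩
      simp only [Finset.mem_filter, Finset.mem_univ, true_and, ht, hf] at h
      exact h.symm
    · ext m
      simp only [Finset.mem_image, Finset.mem_filter, Finset.mem_univ, true_and]
      constructor
      · rintro ⟨v, hv, rfl⟩
        exact hv
      · intro hm
        have hlt := h1 m hm
        rcases Nat.even_or_odd' m with ⟨i, rfl | rfl⟩
        · exact ⟨(⟨i, by omega⟩, false), hm, rfl⟩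
        · exact ⟨(⟨i, by omega⟩, true), hm, rfl⟩

theorem card_image_faces {α : Type*} (Δ : FinComplex α) {f : α → ℕ}
    (hf : Set.InjOn f Δ.ground) : (Δ.faces.image (Finset.image f)).card = Δ.faces.card := by
  refine Finset.card_image_of_injOn fun F hF F' hF' h => ?_
  have hs : ∀ G ∈ Δ.faces, (G : Set α) ⊆ Δ.ground := fun G hG =>
    Finset.coe_subset.2 (Δ.subset_ground G hG)
  have h' : f '' (F : Set α) = f '' (F' : Set α) := by
    rw [← Finset.coe_image, ← Finset.coe_image]
    exact congrArg _ h
  exact Finset.coe_injective ((hf.image_eq_image_iff (hs F hF) (hs F' hF')).1 h')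

/-! ### Grapes and their simple-homotopy type -/

section Grapes

variable {α : Type*}

theorem ext_faces {Δ Γ : FinComplex α} (hg : Δ.ground = Γ.ground)
    (hf : ∀ F, F ∈ Δ.faces ↔ F ∈ Γ.faces) : Δ = Γ := by
  obtain ⟨X, K, _, _⟩ := Δ
  obtain ⟨Y, L, _, _⟩ := Γ
  obtain rfl : X = Y := hg
  obtain rfl : K = L := Finset.ext hf
  rfl

theorem apply_mem_image_iff (Δ : FinComplex α) {f : α → ℕ} (hf : Set.InjOn f Δ.ground) {a : α}
    (ha : a ∈ Δ.ground) {F : Finset α} (hF : F ∈ Δ.faces) : f a ∈ F.image f ↔ a ∈ F := by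
  rw [← Finset.mem_coe, Finset.coe_image,
    hf.mem_image_iff (Finset.coe_subset.2 (Δ.subset_ground F hF)) ha, Finset.mem_coe]

theorem isLowerSet_image_faces (Δ : FinComplex α) (f : α → ℕ) :
    IsLowerSet (Δ.faces.image (Finset.image f) : Set (Finset ℕ)) := by
  intro F F' hle hF
  obtain ⟨F, hF', rfl⟩ := Finset.mem_image.1 hF
  obtain ⟨G, hG, rfl⟩ := Finset.subset_image_iff.1 hle
  exact Finset.mem_image_of_mem _ (Δ.down_closed F hF' G (Finset.coe_subset.1 hG))

variable [DecidableEq α]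

theorem image_deletion_faces (Δ : FinComplex α) {f : α → ℕ} (hf : Set.InjOn f Δ.ground) {a : α}
    (ha : a ∈ Δ.ground) : (Δ.deletion a).faces.image (Finset.image f) =
      (Δ.faces.image (Finset.image f)).filter fun F => f a ∉ F := by
  ext G
  simp only [deletion, Finset.mem_image, Finset.mem_filter]
  constructor
  · rintro ⟨F, ⟨h1, h2⟩, rfl⟩
    refine ⟨⟨F, h1, rfl⟩, ?_⟩
    rwa [apply_mem_image_iff Δ hf ha h1]
  · rintro ⟨⟨F, h1, rfl⟩, h2⟩
    refine ⟨F, ⟨h1, fun h => h2 ?_⟩, rfl⟩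
    exact Finset.mem_image_of_mem f h

theorem insert_image_mem_iff (Δ : FinComplex α) {f : α → ℕ} (hf : Set.InjOn f Δ.ground) {a : α}
    (ha : a ∈ Δ.ground) {F : Finset α} (hF : F ∈ Δ.faces) :
    insert (f a) (F.image f) ∈ Δ.faces.image (Finset.image f) ↔ insert a F ∈ Δ.faces := by
  rw [← Finset.image_insert, Finset.mem_image]
  constructor
  · rintro ⟨G, hG, h⟩
    convert hG using 1
    have h' : f '' ((insert a F : Finset α) : Set α) = f '' (G : Set α) := by
      rw [← Finset.coe_image, ← Finset.coe_image, h]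
    refine Finset.coe_injective ((hf.image_eq_image_iff ?_ ?_).1 h')
    · exact Finset.coe_subset.2 (Finset.insert_subset ha (Δ.subset_ground F hF))
    · exact Finset.coe_subset.2 (Δ.subset_ground G hG)
  · exact fun h => ⟨_, h, rfl⟩

theorem image_link_faces (Δ : FinComplex α) {f : α → ℕ} (hf : Set.InjOn f Δ.ground) {a : α}
    (ha : a ∈ Δ.ground) : (Δ.link a).faces.image (Finset.image f) =
      (Δ.faces.image (Finset.image f)).filter fun F =>
        f a ∉ F ∧ insert (f a) F ∈ Δ.faces.image (Finset.image f) := by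
  ext G
  constructor
  · intro h
    obtain ⟨F, hF, rfl⟩ := Finset.mem_image.1 h
    obtain ⟨h1, h2, h3⟩ := Finset.mem_filter.1 hF
    refine Finset.mem_filter.2 ⟨Finset.mem_image_of_mem _ h1, ?_, ?_⟩
    · rwa [apply_mem_image_iff Δ hf ha h1]
    · rwa [insert_image_mem_iff Δ hf ha h1]
  · intro h
    obtain ⟨h1, h2, h3⟩ := Finset.mem_filter.1 h
    obtain ⟨F, hF, rfl⟩ := Finset.mem_image.1 h1
    rw [apply_mem_image_iff Δ hf ha hF] at h2
    rw [insert_image_mem_iff Δ hf ha hF] at h3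
    exact Finset.mem_image_of_mem _ (Finset.mem_filter.2 ⟨hF, h2, h3⟩)

/-- Every cone is a strong combinatorial grape: all links and deletions of points other than the
apex are cones with the same apex. -/
theorem IsCone.isStrongGrape {Δ : FinComplex α} (h : Δ.IsCone) : Δ.IsStrongGrape := by
  induction hn : Δ.ground.card generalizing Δ with
  | zero =>
    obtain ⟨x, hx, -⟩ := h
    rw [Finset.card_eq_zero.1 hn] at hx
    exact absurd hx (Finset.notMem_empty x)
  | succ n ih =>
    obtain ⟨x, hx, hcone⟩ := h
    by_cases h1 : ∃ a ∈ Δ.ground, a ≠ x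
    · obtain ⟨a, ha, hax⟩ := h1
      have hlk : (Δ.link a).IsCone := by
        refine ⟨x, Finset.mem_erase.2 ⟨hax.symm, hx⟩, fun F hF => ?_⟩
        obtain ⟨h1, h2, h3⟩ := Finset.mem_filter.1 hF
        refine Finset.mem_filter.2 ⟨hcone F h1, ?_, ?_⟩
        · simp [h2, hax]
        · rw [Finset.insert_comm]
          exact hcone _ h3
      have hdl : (Δ.deletion a).IsCone := by
        refine ⟨x, Finset.mem_erase.2 ⟨hax.symm, hx⟩, fun F hF => ?_⟩
        obtain ⟨h1, h2⟩ := Finset.mem_filter.1 hF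
        refine Finset.mem_filter.2 ⟨hcone F h1, ?_⟩
        simp [h2, hax]
      have hcard : (Δ.ground.erase a).card = n := by
        rw [Finset.card_erase_of_mem ha, hn, Nat.add_sub_cancel]
      exact IsStrongGrape.step Δ a ha (Or.inl hlk) (ih hdl hcard) (ih hlk hcard)
    · push Not at h1
      refine IsStrongGrape.base Δ (Finset.card_le_one.2 fun a ha b hb => ?_)
      rw [h1 a (Finset.mem_filter.1 ha).1, h1 b (Finset.mem_filter.1 hb).1]

/-- The standard model in `ℕ` of a simple-homotopy type: `none` stands for the void complex and
`some n` for the boundary of the `n`-dimensional cross-polytope. -/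
def typeFaces : Option ℕ → Finset (Finset ℕ)
  | none => ∅
  | some n => sphereFaces n

theorem typeFaces_map_succ (o : Option ℕ) :
    typeFaces (o.map Nat.succ) = suspension (typeFaces o) := by
  cases o <;> rfl

/-- `Δ` is a strong combinatorial grape of the simple-homotopy type encoded by `o`. All labellings
of the ground set are allowed, so that a labelling for `Δ` also serves its links and deletions. -/
def IsGrapeOfType (Δ : FinComplex α) (o : Option ℕ) : Prop :=
  Δ.IsStrongGrape ∧ ∀ f : α → ℕ, Set.InjOn f Δ.ground →
    Relation.EqvGen SimpleMove (Δ.faces.image (Finset.image f)) (typeFaces o)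

theorem IsCone.isGrapeOfType {Δ : FinComplex α} (h : Δ.IsCone) : Δ.IsGrapeOfType none := by
  refine ⟨h.isStrongGrape, fun f hf => ?_⟩
  obtain ⟨x, hx, hcone⟩ := h
  refine eqvGen_empty_of_cone (x := f x) (Δ.isLowerSet_image_faces f) fun F hF => ?_
  obtain ⟨F, hF', rfl⟩ := Finset.mem_image.1 hF
  exact (insert_image_mem_iff Δ hf hx hF').2 (hcone F hF')

theorem IsGrapeOfType.of_link_isCone {Δ : FinComplex α} {a : α} {o : Option ℕ}
    (ha : a ∈ Δ.ground) (h : (Δ.link a).IsCone) (hdl : (Δ.deletion a).IsGrapeOfType o) :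
    Δ.IsGrapeOfType o := by
  refine ⟨IsStrongGrape.step Δ a ha (Or.inl h) hdl.1 h.isStrongGrape, fun f hf => ?_⟩
  have h1 := hdl.2 f (hf.mono (Finset.coe_subset.2 (Finset.erase_subset a _)))
  rw [image_deletion_faces Δ hf ha] at h1
  refine Relation.EqvGen.trans _ _ _ ?_ h1
  obtain ⟨x, hx, hcone⟩ := h
  obtain ⟨hxa, hx⟩ := Finset.mem_erase.1 hx
  refine eqvGen_deletion_of_link_cone (Δ.isLowerSet_image_faces f) (x := f x)
    (fun h => hxa (hf hx ha h)) fun F hF haF => ?_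
  obtain ⟨F, hF', rfl⟩ := Finset.mem_image.1 hF
  rw [apply_mem_image_iff Δ hf ha hF'] at haF
  rw [insert_image_mem_iff Δ hf hx hF']
  have := hcone (F.erase a) (Finset.mem_filter.2 ⟨Δ.down_closed F hF' _ (Finset.erase_subset a F),
    Finset.notMem_erase a F, by rwa [Finset.insert_erase haF]⟩)
  have := (Finset.mem_filter.1 this).2.2
  rwa [Finset.insert_comm, Finset.insert_erase haF] at this

theorem IsGrapeOfType.of_deletion_isCone {Δ : FinComplex α} {a : α} {o : Option ℕ}
    (ha : a ∈ Δ.ground) (h : (Δ.deletion a).IsCone) (hlk : (Δ.link a).IsGrapeOfType o) :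
    Δ.IsGrapeOfType (o.map Nat.succ) := by
  refine ⟨IsStrongGrape.step Δ a ha (Or.inr h) h.isStrongGrape hlk.1, fun f hf => ?_⟩
  have h1 := hlk.2 f (hf.mono (Finset.coe_subset.2 (Finset.erase_subset a _)))
  rw [image_link_faces Δ hf ha] at h1
  rw [typeFaces_map_succ]
  refine Relation.EqvGen.trans _ _ _ ?_ (eqvGen_suspension h1)
  obtain ⟨x, hx, hcone⟩ := h
  obtain ⟨hxa, hx⟩ := Finset.mem_erase.1 hx
  refine eqvGen_suspension_link_of_deletion_cone (Δ.isLowerSet_image_faces f) (x := f x)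
    (fun h => hxa (hf hx ha h)) fun F hF haF => ?_
  obtain ⟨F, hF', rfl⟩ := Finset.mem_image.1 hF
  rw [apply_mem_image_iff Δ hf ha hF'] at haF
  rw [insert_image_mem_iff Δ hf hx hF']
  exact (Finset.mem_filter.1 (hcone F (Finset.mem_filter.2 ⟨hF', haF⟩))).1

theorem IsGrapeOfType.equiv_void [Finite α] {Δ : FinComplex α} (h : Δ.IsGrapeOfType none) :
    Δ.SimpleHomotopyEquiv (void (∅ : Finset ℕ)) := by
  obtain ⟨n, ⟨e⟩⟩ := Finite.exists_equiv_fin α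
  have he : Function.Injective fun a => (e a : ℕ) := Fin.val_injective.comp e.injective
  exact ⟨_, id, he.injOn, Function.injective_id.injOn, h.2 _ he.injOn⟩

theorem IsGrapeOfType.equiv_crossPolytopeBoundary [Finite α] {Δ : FinComplex α} {n : ℕ}
    (h : Δ.IsGrapeOfType (some n)) : Δ.SimpleHomotopyEquiv (crossPolytopeBoundary n) := by
  obtain ⟨m, ⟨e⟩⟩ := Finite.exists_equiv_fin α
  have he : Function.Injective fun a => (e a : ℕ) := Fin.val_injective.comp e.injective
  refine ⟨_, crossPolytopeLabel n, he.injOn, (crossPolytopeLabel_injective n).injOn, ?_⟩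
  rw [image_crossPolytopeBoundary]
  exact h.2 _ he.injOn

/-- A contractible complex is not simple-homotopy equivalent to a cross-polytope boundary: the
former has an even number of faces and the latter has `3 ^ n`. -/
theorem IsGrapeOfType.not_equiv_crossPolytopeBoundary {Δ : FinComplex α}
    (h : Δ.IsGrapeOfType none) (n : ℕ) :
    ¬ Δ.SimpleHomotopyEquiv (crossPolytopeBoundary n) := by
  rintro ⟨f, g, hf, hg, hfg⟩
  have h1 := card_mod_two_of_eqvGen (h.2 f hf)
  have h2 := card_mod_two_of_eqvGen hfg
  have h3 := card_image_faces (crossPolytopeBoundary n) (crossPolytopeLabel_injective n).injOn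
  rw [image_crossPolytopeBoundary, card_sphereFaces] at h3
  rw [card_image_faces _ hg, ← h3, h1] at h2
  have h4 : Odd (3 ^ n) := Odd.pow (by decide)
  rw [Nat.odd_iff, ← h2] at h4
  simp [typeFaces] at h4

end Grapes

/-! ### Complexes of non-transversals -/

section NonTransversal

variable {α ι : Type*}

open Classical in
/-- The complex of non-transversals of a hypergraph: the points are the elements of `Y`, the
hyperedges are the sets `{y ∈ Y | R y i}` for `i ∈ J`, and a face is a set of points that misses
some hyperedge. -/
noncomputable def nonTransversal (R : α → ι → Prop) (Y : Finset α) (J : Set ι) : FinComplex α where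
  ground := Y
  faces := Y.powerset.filter fun F => ∃ i ∈ J, ∀ y ∈ F, ¬ R y i
  subset_ground := fun F hF => Finset.mem_powerset.1 (Finset.mem_filter.1 hF).1
  down_closed := by
    intro F hF F' hF'
    rw [Finset.mem_filter, Finset.mem_powerset] at hF ⊢
    obtain ⟨h, i, hi, hFi⟩ := hF
    exact ⟨hF'.trans h, i, hi, fun y hy => hFi y (hF' hy)⟩

variable {R : α → ι → Prop} {Y : Finset α} {J : Set ι}

theorem mem_nonTransversal {F : Finset α} :
    F ∈ (nonTransversal R Y J).faces ↔ F ⊆ Y ∧ ∃ i ∈ J, ∀ y ∈ F, ¬ R y i := by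
  classical
  rw [nonTransversal, Finset.mem_filter, Finset.mem_powerset]

variable [DecidableEq α]

theorem nonTransversal_deletion (y : α) :
    (nonTransversal R Y J).deletion y = nonTransversal R (Y.erase y) J := by
  refine ext_faces rfl fun F => ?_
  rw [deletion, Finset.mem_filter, mem_nonTransversal, mem_nonTransversal, Finset.subset_erase]
  tauto

theorem nonTransversal_link {y : α} (hy : y ∈ Y) :
    (nonTransversal R Y J).link y = nonTransversal R (Y.erase y) {i ∈ J | ¬ R y i} := by
  refine ext_faces rfl fun F => ?_
  rw [link, Finset.mem_filter, mem_nonTransversal, mem_nonTransversal, mem_nonTransversal,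
    Finset.subset_erase]
  constructor
  · rintro ⟨⟨h1, -⟩, h2, -, i, hi, h⟩
    exact ⟨⟨h1, h2⟩, i, ⟨hi, h y (Finset.mem_insert_self _ _)⟩,
      fun z hz => h z (Finset.mem_insert_of_mem hz)⟩
  · rintro ⟨⟨h1, h2⟩, i, ⟨hi, hyi⟩, h⟩
    refine ⟨⟨h1, i, hi, h⟩, h2, Finset.insert_subset hy h1, i, hi, fun z hz => ?_⟩
    rcases Finset.mem_insert.1 hz with rfl | hz
    · exact hyi
    · exact h z hz

/-- A point which lies in no minimal hyperedge is the apex of a cone. -/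
theorem isCone_nonTransversal {x : α} (hx : x ∈ Y)
    (h : ∀ i ∈ J, R x i → ∃ i' ∈ J, ¬ R x i' ∧ ∀ y ∈ Y, R y i' → R y i) :
    (nonTransversal R Y J).IsCone := by
  refine ⟨x, hx, fun F hF => ?_⟩
  rw [mem_nonTransversal] at hF ⊢
  obtain ⟨hFY, i, hi, hFi⟩ := hF
  refine ⟨Finset.insert_subset hx hFY, ?_⟩
  by_cases hxi : R x i
  · obtain ⟨i', hi', hx', hsub⟩ := h i hi hxi
    refine ⟨i', hi', fun y hy => ?_⟩
    rcases Finset.mem_insert.1 hy with rfl | hy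
    · exact hx'
    · exact fun hyi => hFi y hy (hsub y (hFY hy) hyi)
  · refine ⟨i, hi, fun y hy => ?_⟩
    rcases Finset.mem_insert.1 hy with rfl | hy
    · exact hxi
    · exact hFi y hy

/-- If each hyperedge through `x` contains `T`, then the points of `T` can be deleted: the link of
such a point is a cone with apex `x`. -/
theorem isGrapeOfType_of_sdiff {x : α} (hx : x ∈ Y) {o : Option ℕ} {T : Finset α} (hxT : x ∉ T)
    (hTY : T ⊆ Y) (hT : ∀ y ∈ T, ∀ i ∈ J, R x i → R y i)
    (h : (nonTransversal R (Y \ T) J).IsGrapeOfType o) :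
    (nonTransversal R Y J).IsGrapeOfType o := by
  induction T using Finset.induction_on with
  | empty => simpa using h
  | insert y T hyT ih =>
    rw [Finset.mem_insert, not_or] at hxT
    have hyY : y ∈ Y := hTY (Finset.mem_insert_self _ _)
    have hxY : x ∈ Y \ T := Finset.mem_sdiff.2 ⟨hx, hxT.2⟩
    have hy : y ∈ Y \ T := Finset.mem_sdiff.2 ⟨hyY, hyT⟩
    refine ih hxT.2 (fun z hz => hTY (Finset.mem_insert_of_mem hz))
      (fun z hz => hT z (Finset.mem_insert_of_mem hz)) ?_
    refine IsGrapeOfType.of_link_isCone (a := y) hy ?_ ?_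
    · rw [nonTransversal_link hy]
      refine isCone_nonTransversal (Finset.mem_erase.2 ⟨hxT.1, hxY⟩) ?_
      rintro i ⟨hi, hyi⟩ hxi
      exact absurd (hT y (Finset.mem_insert_self _ _) i hi hxi) hyi
    · rw [nonTransversal_deletion]
      rwa [← Finset.sdiff_insert]

/-- The outcome of the elimination process for the non-transversals of a hypergraph: `none` if the
complex is contractible, and `some k` if `k` steps exhaust both the points and the hyperedges, in
which case the complex is a sphere `∂β_{k-1}` for `k ≠ 0`. The empty hypergraph on the empty set of
points is the outcome `some 0`, where the complex is void but its step predecessor is `{∅}`; a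
nonempty family of hyperedges on the empty set of points gives `none`, since its complex is `{∅}`
but its step predecessor is contractible. -/
def HasOutcome (R : α → ι → Prop) (Y : Finset α) (J : Set ι) : Option ℕ → Prop
  | none => (Y.Nonempty ∧ (nonTransversal R Y J).IsGrapeOfType none) ∨ (Y = ∅ ∧ J.Nonempty)
  | some 0 => Y = ∅ ∧ J = ∅
  | some (n + 1) => Y.Nonempty ∧ (nonTransversal R Y J).IsGrapeOfType (some n)

theorem HasOutcome.none_of_forall {x : α} (hx : x ∈ Y)
    (h : ∀ i ∈ J, R x i → ∃ i' ∈ J, ¬ R x i' ∧ ∀ y ∈ Y, R y i' → R y i) :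
    HasOutcome R Y J none :=
  Or.inl ⟨⟨x, hx⟩, (isCone_nonTransversal hx h).isGrapeOfType⟩

/-- The elimination step. If the hyperedge `i` is the smallest one through the point `x`, then one
may delete all points of `i` except `x`; then the deletion of `x` is a full simplex, and the link of
`x` is the complex of the hypergraph with the points of `i` and the hyperedges through `x`
removed. -/
theorem HasOutcome.step {x : α} {i : ι} (hx : x ∈ Y) (hi : i ∈ J) (hxi : R x i)
    (hmin : ∀ i' ∈ J, R x i' → ∀ y ∈ Y, R y i → R y i') {Y' : Finset α} {J' : Set ι}
    (hY' : ∀ y, y ∈ Y' ↔ y ∈ Y ∧ ¬ R y i) (hJ' : ∀ i', i' ∈ J' ↔ i' ∈ J ∧ ¬ R x i')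
    {o : Option ℕ} (h : HasOutcome R Y' J' o) : HasOutcome R Y J (o.map Nat.succ) := by
  classical
  set T := (Y \ Y').erase x with hT
  have hxT : x ∉ T := Finset.notMem_erase x _
  have hTY : T ⊆ Y := (Finset.erase_subset x _).trans Finset.sdiff_subset
  have hTi : ∀ y ∈ T, R y i := by
    intro y hy
    have := Finset.mem_sdiff.1 (Finset.mem_of_mem_erase hy)
    by_contra hc
    exact this.2 ((hY' y).2 ⟨this.1, hc⟩)
  have hdel : ∀ {o}, (nonTransversal R (Y \ T) J).IsGrapeOfType o →
      (nonTransversal R Y J).IsGrapeOfType o := fun h =>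
    isGrapeOfType_of_sdiff hx hxT hTY (fun y hy i' hi' hxi' => hmin i' hi' hxi' y (hTY hy)
      (hTi y hy)) h
  have hYT : (Y \ T).erase x = Y' := by
    ext y
    simp only [hT, Finset.mem_erase, Finset.mem_sdiff, hY']
    constructor
    · rintro ⟨h1, h2, h3⟩
      exact ⟨h2, fun hyi => h3 ⟨h1, h2, fun h => h.2 hyi⟩⟩
    · rintro ⟨h1, h2⟩
      exact ⟨fun h => h2 (h ▸ hxi), h1, fun h => h.2.2 ⟨h1, h2⟩⟩
  have hxYT : x ∈ Y \ T := Finset.mem_sdiff.2 ⟨hx, hxT⟩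
  have hJ'eq : {i' ∈ J | ¬ R x i'} = J' := by
    ext i'
    exact (hJ' i').symm
  have hmain : ∀ {o}, Y'.Nonempty → (nonTransversal R Y' J').IsGrapeOfType o →
      (nonTransversal R Y J).IsGrapeOfType (o.map Nat.succ) := by
    rintro o ⟨y, hy⟩ h
    refine hdel (IsGrapeOfType.of_deletion_isCone (a := x) hxYT ?_ ?_)
    · rw [nonTransversal_deletion, hYT]
      refine ⟨y, hy, fun F hF => ?_⟩
      rw [mem_nonTransversal] at hF ⊢
      have hs := Finset.insert_subset hy hF.1
      exact ⟨hs, i, hi, fun z hz => ((hY' z).1 (hs hz)).2⟩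
    · rwa [nonTransversal_link hxYT, hYT, hJ'eq]
  match o, h with
  | none, Or.inl h => exact Or.inl ⟨⟨x, hx⟩, hmain h.1 h.2⟩
  | none, Or.inr ⟨h1, i', hi'⟩ =>
    -- the hyperedge `i'` is strictly contained in all hyperedges through `x`
    refine HasOutcome.none_of_forall hx fun i₁ hi₁ hxi₁ => ?_
    rw [hJ'] at hi'
    refine ⟨i', hi'.1, hi'.2, fun y hy _ => hmin i₁ hi₁ hxi₁ y hy ?_⟩
    by_contra hc
    have := (hY' y).2 ⟨hy, hc⟩
    rw [h1] at this
    exact Finset.notMem_empty y this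
  | some 0, ⟨h1, h2⟩ =>
    refine ⟨⟨x, hx⟩, hdel ?_⟩
    have hg : Y \ T = {x} := by
      rw [← Finset.insert_erase hxYT, hYT, h1]
      rfl
    rw [hg]
    have hf : (nonTransversal R {x} J).faces = {∅} := by
      ext F
      rw [mem_nonTransversal, Finset.mem_singleton, Finset.subset_singleton_iff]
      constructor
      · rintro ⟨rfl | rfl, i', hi', h⟩
        · rfl
        · have : i' ∈ J' := (hJ' i').2 ⟨hi', h x (Finset.mem_singleton_self x)⟩
          rw [h2] at this
          exact absurd this (Set.notMem_empty i')
      · rintro rfl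
        exact ⟨Or.inl rfl, i, hi, fun y hy => absurd hy (Finset.notMem_empty y)⟩
    refine ⟨IsStrongGrape.base _ ?_, fun f _ => ?_⟩
    · exact (Finset.card_filter_le _ _).trans (Finset.card_singleton x).le
    · rw [hf]
      exact Relation.EqvGen.refl _
  | some (n + 1), h => exact ⟨⟨x, hx⟩, hmain h.1 h.2⟩

theorem HasOutcome.isStrongGrape {o : Option ℕ} (h : HasOutcome R Y J o) :
    (nonTransversal R Y J).IsStrongGrape := by
  match o, h with
  | none, Or.inl h => exact h.2.1
  | none, Or.inr ⟨h, _⟩ | some 0, ⟨h, _⟩ =>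
    subst h
    exact IsStrongGrape.base _ ((Finset.card_filter_le _ _).trans (by simp [nonTransversal]))
  | some (n + 1), h => exact h.2.1

end NonTransversal

end FinComplex

/-! ### Depth functions on forests -/

namespace SimpleGraph

open FinComplex

variable {V : Type*} {G : SimpleGraph V}

/-- A depth function for rooted forests: adjacent vertices have different depths, and each vertex
has at most one neighbour of smaller depth, its parent. -/
structure IsDepth (G : SimpleGraph V) (d : V → ℕ) : Prop where
  ne_of_adj : ∀ {u v}, G.Adj u v → d u ≠ d v
  parent_unique : ∀ {v u w}, G.Adj v u → G.Adj v w → d u < d v → d w < d v → u = w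

/-- In a forest, the distance from a chosen root of each component is a depth function. -/
theorem IsAcyclic.exists_isDepth (hG : G.IsAcyclic) : ∃ d : V → ℕ, G.IsDepth d := by
  classical
  let r : V → V := fun v => (G.connectedComponentMk v).out
  have hr : ∀ {u v}, G.Adj u v → r u = r v := fun h =>
    congrArg Quot.out (ConnectedComponent.sound h.reachable)
  have hreach : ∀ v, G.Reachable (r v) v := fun v =>
    ConnectedComponent.exact (Quot.out_eq (G.connectedComponentMk v))
  refine ⟨fun v => G.dist (r v) v, ⟨?_, ?_⟩⟩
  · intro u v h
    have := hG.dist_ne_of_adj h (hreach u)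
    rwa [hr h] at this ⊢
  · intro v u w hu hw hdu hdw
    rw [hr hu.symm] at hdu
    rw [hr hw.symm] at hdw
    have key : ∀ {z}, G.Adj v z → G.dist (r v) z < G.dist (r v) v →
        ∃ p : G.Walk (r v) v, p.IsPath ∧ p.penultimate = z := by
      intro z hz hd
      have hrz : G.Reachable (r v) z := (hreach v).trans hz.reachable
      obtain ⟨p, hp, hlen⟩ := hrz.exists_path_of_dist
      refine ⟨p.concat hz.symm, hp.concat ?_ hz.symm, p.penultimate_concat hz.symm⟩
      intro hv
      have h1 := dist_le (p.takeUntil v hv)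
      have h2 := p.length_takeUntil_le_length hv
      omega
    obtain ⟨p, hp, rfl⟩ := key hu hdu
    obtain ⟨q, hq, rfl⟩ := key hw hdw
    have := (hG.subsingleton_path _ _).elim ⟨p, hp⟩ ⟨q, hq⟩
    rw [Subtype.mk.injEq] at this
    rw [this]

variable {d : V → ℕ}

/-- In a nonempty set of edges of a forest there is an edge `{x, p}`, with `p` the parent of `x`,
which is the only edge of the set at `x` and whose end `x` is deepest. -/
theorem IsDepth.exists_deepest_edge (hd : G.IsDepth d) {Y : Finset (Sym2 V)}
    (hY : ∀ e ∈ Y, e ∈ G.edgeSet) (hne : Y.Nonempty) :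
    ∃ x p, s(x, p) ∈ Y ∧ G.Adj x p ∧ d p < d x ∧ (∀ q, s(x, q) ∈ Y → q = p) ∧
      ∀ u w, s(u, w) ∈ Y → d u ≤ d x := by
  classical
  have hU : (Y.biUnion Sym2.toFinset).Nonempty := by
    obtain ⟨e, he⟩ := hne
    induction e with
    | h u w => exact ⟨u, Finset.mem_biUnion.2 ⟨_, he, by simp⟩⟩
  obtain ⟨x, hx, hmax⟩ := (Y.biUnion Sym2.toFinset).exists_max_image d hU
  have hmax' : ∀ u w, s(u, w) ∈ Y → d u ≤ d x := fun u w h =>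
    hmax u (Finset.mem_biUnion.2 ⟨_, h, by simp⟩)
  obtain ⟨e, he, hxe⟩ := Finset.mem_biUnion.1 hx
  obtain ⟨p, rfl⟩ := Sym2.mem_iff_exists.1 (Sym2.mem_toFinset.1 hxe)
  have hlt : ∀ q, s(x, q) ∈ Y → d q < d x := fun q hq =>
    lt_of_le_of_ne (hmax' q x (Sym2.eq_swap ▸ hq)) (hd.ne_of_adj (hY _ hq)).symm
  exact ⟨x, p, he, hY _ he, hlt p he,
    fun q hq => hd.parent_unique (hY _ hq) (hY _ he) (hlt q hq) (hlt p he), hmax'⟩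

/-! ### Closed neighbourhoods in graphs with simplicial elimination -/

/-- Let `R` be a reflexive symmetric relation such that each nonempty subset of `X` has an element
`x` whose neighbours in the subset are pairwise related. Then the non-transversals of the closed
neighbourhoods form a sphere: the neighbourhood of `x` is the smallest one through `x`, and the
elimination step removes precisely this neighbourhood from both the points and the hyperedges. The
chosen elements `x` form an independent set `I`; if the neighbours of each of them are related by
`T` to a single element of `κ`, then `|I|` elements of `κ` suffice for the whole set. -/
theorem exists_hasOutcome_of_simplicial {α κ : Type*} [DecidableEq α] [DecidableEq κ]
    {R : α → α → Prop} (hrefl : ∀ a, R a a) (hsymm : ∀ a b, R a b → R b a) {T : α → κ → Prop}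
    {X : Finset α}
    (hX : ∀ Y ⊆ X, Y.Nonempty → ∃ x ∈ Y, (∀ u ∈ Y, ∀ v ∈ Y, R x u → R x v → R u v) ∧
      ∃ w, ∀ u ∈ Y, R x u → T u w) :
    ∀ Y ⊆ X, ∃ (I : Finset α) (W : Finset κ), I ⊆ Y ∧ HasOutcome R Y (Y : Set α) (some I.card) ∧
      (∀ a ∈ I, ∀ b ∈ I, R a b → a = b) ∧ W.card ≤ I.card ∧ ∀ y ∈ Y, ∃ w ∈ W, T y w := by
  classical
  intro Y
  induction Y using Finset.strongInduction with
  | H Y ih =>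
    intro hYX
    rcases Y.eq_empty_or_nonempty with rfl | hne
    · exact ⟨∅, ∅, subset_rfl, ⟨rfl, Finset.coe_empty⟩, by simp, le_rfl, by simp⟩
    obtain ⟨x, hx, hclique, w, hw⟩ := hX Y hYX hne
    have hY' : ∀ y, y ∈ Y.filter (fun y => ¬ R y x) ↔ y ∈ Y ∧ ¬ R y x := fun y =>
      Finset.mem_filter
    have hss : Y.filter (fun y => ¬ R y x) ⊂ Y :=
      Finset.filter_ssubset.2 ⟨x, hx, fun h => h (hrefl x)⟩
    obtain ⟨I, W, hIY, hout, hI, hcard, hW⟩ := ih _ hss (hss.subset.trans hYX)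
    have hxI : x ∉ I := fun h => ((hY' x).1 (hIY h)).2 (hrefl x)
    refine ⟨insert x I, insert w W, Finset.insert_subset hx (hIY.trans hss.subset), ?_, ?_, ?_, ?_⟩
    · rw [Finset.card_insert_of_notMem hxI]
      refine HasOutcome.step (o := some I.card) hx (Finset.mem_coe.2 hx) (hrefl x) ?_ hY' ?_ hout
      · intro i' hi' hxi' y hy hyx
        exact hclique y hy i' hi' (hsymm _ _ hyx) hxi'
      · intro i'
        rw [Finset.mem_coe, hY', Finset.mem_coe]
        exact and_congr_right fun _ => not_congr ⟨hsymm _ _, hsymm _ _⟩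
    · have hx' : ∀ b ∈ I, ¬ R b x := fun b hb => ((hY' b).1 (hIY hb)).2
      intro a ha b hb hab
      rcases Finset.mem_insert.1 ha with rfl | ha' <;>
        rcases Finset.mem_insert.1 hb with rfl | hb'
      · rfl
      · exact absurd (hsymm _ _ hab) (hx' b hb')
      · exact absurd hab (hx' a ha')
      · exact hI a ha' b hb' hab
    · rw [Finset.card_insert_of_notMem hxI]
      exact (Finset.card_insert_le w W).trans (Nat.succ_le_succ hcard)
    · intro y hy
      by_cases hyx : R y x
      · exact ⟨w, Finset.mem_insert_self _ _, hw y hy (hsymm _ _ hyx)⟩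
      · obtain ⟨w', hw', h⟩ := hW y ((hY' y).2 ⟨hy, hyx⟩)
        exact ⟨w', Finset.mem_insert_of_mem hw', h⟩

theorem IsDepth.exists_hasOutcome_dominance [Fintype V] [DecidableEq V] (hd : G.IsDepth d) :
    ∃ n : ℕ, (n : ℕ∞) + G.vertexCoverNum = (Fintype.card V : ℕ∞) ∧
      HasOutcome (fun u v => u = v ∨ G.Adj u v) Finset.univ
        ((Finset.univ : Finset V) : Set V) (some n) := by
  classical
  have h := exists_hasOutcome_of_simplicial (R := fun u v => u = v ∨ G.Adj u v) (κ := Finset V)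
    (T := fun y C => y ∈ C ∧ ∀ u ∈ C, ∀ v ∈ C, u = v ∨ G.Adj u v) (X := Finset.univ)
    (fun a => Or.inl rfl) (fun a b h => h.imp Eq.symm fun h => h.symm) ?_ Finset.univ subset_rfl
  · obtain ⟨I, W, -, hout, hI, hcard, hW⟩ := h
    refine ⟨I.card, ?_, hout⟩
    have hle : G.vertexCoverNum ≤ ((Finset.univ \ I).card : ℕ∞) := by
      rw [← Set.encard_coe_eq_coe_finsetCard]
      refine IsVertexCover.vertexCoverNum_le fun u v huv => ?_
      simp only [Finset.coe_sdiff, Finset.coe_univ, Set.mem_sdiff, Set.mem_univ, true_and,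
        Finset.mem_coe]
      by_contra! hc
      exact huv.ne (hI u hc.1 v hc.2 (Or.inr huv))
    obtain ⟨c, hc, hcov⟩ := G.vertexCoverNum_exists
    have hge : (Finset.univ \ c.toFinset).card ≤ I.card := by
      refine le_trans (Finset.card_le_card_of_forall_subsingleton
        (fun y C => y ∈ C ∧ ∀ u ∈ C, ∀ v ∈ C, u = v ∨ G.Adj u v) (t := W) ?_ ?_) hcard
      · intro y _
        exact hW y (Finset.mem_univ y)
      · rintro C - u ⟨hu, hu1, hu2⟩ v ⟨hv, hv1, -⟩
        rcases hu2 u hu1 v hv1 with h | h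
        · exact h
        · simp only [Finset.mem_sdiff, Finset.mem_univ, true_and, Set.mem_toFinset] at hu hv
          rcases hcov h with h | h
          · exact absurd h hu
          · exact absurd h hv
    rw [← hc, Set.encard_eq_coe_toFinset_card] at hle ⊢
    have h1 := Finset.card_sdiff_add_card_eq_card (Finset.subset_univ I)
    have h2 := Finset.card_sdiff_add_card_eq_card (Finset.subset_univ c.toFinset)
    rw [Finset.card_univ] at h1 h2
    norm_cast at hle ⊢
    omega
  · intro Y _ hne
    obtain ⟨x, hx, hmax⟩ := Y.exists_max_image d hne
    have hcl : ∀ u ∈ Y, ∀ v ∈ Y, (x = u ∨ G.Adj x u) → (x = v ∨ G.Adj x v) →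
        (u = v ∨ G.Adj u v) := by
      rintro u hu v hv (rfl | hxu) (rfl | hxv)
      · exact Or.inl rfl
      · exact Or.inr hxv
      · exact Or.inr hxu.symm
      · exact Or.inl (hd.parent_unique hxu hxv (lt_of_le_of_ne (hmax u hu) (hd.ne_of_adj hxu).symm)
          (lt_of_le_of_ne (hmax v hv) (hd.ne_of_adj hxv).symm))
    refine ⟨x, hx, hcl, Y.filter fun u => x = u ∨ G.Adj x u, fun u hu hxu =>
      ⟨Finset.mem_filter.2 ⟨hu, hxu⟩, fun a ha b hb => ?_⟩⟩
    rw [Finset.mem_filter] at ha hb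
    exact hcl a ha.1 b hb.1 ha.2 hb.2

theorem IsDepth.exists_hasOutcome_edgeDominance [Fintype V] [DecidableEq V] [DecidableRel G.Adj]
    (hd : G.IsDepth d) :
    ∃ n : ℕ, (n : ℕ∞) = G.vertexCoverNum ∧
      HasOutcome (fun e f : Sym2 V => ∃ v, v ∈ e ∧ v ∈ f) G.edgeFinset
        (G.edgeFinset : Set (Sym2 V)) (some n) := by
  classical
  have h := exists_hasOutcome_of_simplicial (R := fun e f : Sym2 V => ∃ v, v ∈ e ∧ v ∈ f)
    (T := fun (e : Sym2 V) v => v ∈ e) (X := G.edgeFinset)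
    (fun e => ?_) (fun a b ⟨v, h, h'⟩ => ⟨v, h', h⟩) ?_ G.edgeFinset subset_rfl
  · obtain ⟨I, W, hIE, hout, hI, hcard, hW⟩ := h
    refine ⟨I.card, le_antisymm ?_ ?_, hout⟩
    · obtain ⟨c, hc, hcov⟩ := G.vertexCoverNum_exists
      rw [← hc, Set.encard_eq_coe_toFinset_card, Nat.cast_le]
      refine Finset.card_le_card_of_forall_subsingleton (fun e v => v ∈ e) ?_ ?_
      · intro e he
        have he' := mem_edgeFinset.1 (hIE he)
        induction e with
        | h u v =>
          rcases hcov he' with h | h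
          · exact ⟨u, Set.mem_toFinset.2 h, Sym2.mem_mk_left u v⟩
          · exact ⟨v, Set.mem_toFinset.2 h, Sym2.mem_mk_right u v⟩
      · rintro v - e ⟨he, hve⟩ f ⟨hf, hvf⟩
        exact hI e he f hf ⟨v, hve, hvf⟩
    · refine le_trans ?_ (Nat.cast_le.2 hcard)
      rw [← Set.encard_coe_eq_coe_finsetCard]
      refine IsVertexCover.vertexCoverNum_le fun u v huv => ?_
      obtain ⟨w, hw, h⟩ := hW s(u, v) (mem_edgeFinset.2 huv)
      rcases Sym2.mem_iff.1 h with rfl | rfl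
      · exact Or.inl hw
      · exact Or.inr hw
  · induction e with
    | h u v => exact ⟨u, Sym2.mem_mk_left u v, Sym2.mem_mk_left u v⟩
  · intro Y hY hne
    obtain ⟨x, p, hxp, -, -, huniq, -⟩ :=
      hd.exists_deepest_edge (fun e he => mem_edgeFinset.1 (hY he)) hne
    have hp : ∀ f ∈ Y, (∃ v, v ∈ s(x, p) ∧ v ∈ f) → p ∈ f := by
      rintro f hf ⟨v, hv, hvf⟩
      rcases Sym2.mem_iff.1 hv with rfl | rfl
      · obtain ⟨q, rfl⟩ := Sym2.mem_iff_exists.1 hvf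
        rw [huniq q hf]
        exact Sym2.mem_mk_right _ _
      · exact hvf
    exact ⟨s(x, p), hxp, fun e he f hf h h' => ⟨p, hp e he h, hp f hf h'⟩, p, hp⟩

end SimpleGraph

/-! ### The independence complex and the edge covering complex -/

namespace SimpleGraph

open FinComplex

variable {V : Type*} {G : SimpleGraph V} {d : V → ℕ}

/-- The closed neighbourhoods in `G` of the vertices of `M` are pairwise disjoint. -/
def IsPacking (G : SimpleGraph V) (M : Finset V) : Prop :=
  ∀ v ∈ M, ∀ w ∈ M, ∀ u, (u = v ∨ G.Adj u v) → (u = w ∨ G.Adj u w) → v = w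

theorem IsPacking.insert [DecidableEq V] {M : Finset V} (hM : G.IsPacking M) {x : V}
    (hx : ∀ w ∈ M, ∀ u, (u = x ∨ G.Adj u x) → (u = w ∨ G.Adj u w) → False) :
    G.IsPacking (insert x M) := by
  intro v hv w hw u huv huw
  rcases Finset.mem_insert.1 hv with rfl | hv' <;> rcases Finset.mem_insert.1 hw with rfl | hw'
  · rfl
  · exact (hx w hw' u huv huw).elim
  · exact (hx v hv' u huw huv).elim
  · exact hM v hv' w hw' u huv huw

theorem IsPacking.card_le [DecidableEq V] {M D : Finset V} (hM : G.IsPacking M)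
    (hD : G.IsDominatingSet D) : M.card ≤ D.card := by
  refine Finset.card_le_card_of_forall_subsingleton (fun v u => u = v ∨ G.Adj u v) ?_ ?_
  · exact fun v _ => hD v
  · rintro u - v ⟨hv, huv⟩ w ⟨hw, huw⟩
    exact hM v hv w hw u huv huw

/-- If an independent dominating set has as many elements as there are disjoint closed
neighbourhoods, then both domination numbers have this value. -/
theorem IsPacking.domination_eq [DecidableEq V] {M D : Finset V} (hM : G.IsPacking M)
    (hDi : G.IsIndepSet (D : Set V)) (hD : G.IsDominatingSet D) (hcard : D.card = M.card) :
    G.indepDominationNum = M.card ∧ G.dominationNum = M.card := by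
  have h1 : G.indepDominationNum ≤ M.card := Nat.sInf_le ⟨D, hDi, hD, hcard⟩
  have h2 : G.dominationNum ≤ M.card := Nat.sInf_le ⟨D, hD, hcard⟩
  obtain ⟨D₁, -, hD₁, h₁⟩ : G.indepDominationNum ∈ {n | ∃ D : Finset V, G.IsIndepSet (D : Set V) ∧
      G.IsDominatingSet D ∧ D.card = n} := Nat.sInf_mem ⟨_, D, hDi, hD, rfl⟩
  obtain ⟨D₂, hD₂, h₂⟩ : G.dominationNum ∈ {n | ∃ D : Finset V, G.IsDominatingSet D ∧
      D.card = n} := Nat.sInf_mem ⟨_, D, hD, rfl⟩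
  have h3 := hM.card_le hD₁
  have h4 := hM.card_le hD₂
  omega

/-- The complement of a minimal vertex cover `A` is an independent dominating set. If a packing has
as many elements as this complement, both domination numbers are `|V| - |A|`. -/
theorem IsPacking.domination_eq_of_cover [Fintype V] [DecidableEq V] {M A : Finset V}
    (hM : G.IsPacking M) (hcard : M.card + A.card = Fintype.card V)
    (hcov : ∀ u v, G.Adj u v → u ∈ A ∨ v ∈ A) (hmin : ∀ a ∈ A, ∃ u, G.Adj a u ∧ u ∉ A) :
    A.card + G.indepDominationNum = Fintype.card V ∧
      G.indepDominationNum = G.dominationNum := by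
  have h1 := Finset.card_sdiff_add_card_eq_card (Finset.subset_univ A)
  rw [Finset.card_univ] at h1
  have h := hM.domination_eq (D := Finset.univ \ A) ?_ ?_ (by omega)
  · omega
  · intro u hu v hv _ huv
    simp only [Finset.coe_sdiff, Finset.coe_univ, Set.mem_sdiff, Set.mem_univ, true_and,
      Finset.mem_coe] at hu hv
    rcases hcov u v huv with h | h
    · exact hu h
    · exact hv h
  · intro v
    by_cases hv : v ∈ A
    · obtain ⟨u, hvu, hu⟩ := hmin v hv
      exact ⟨u, by simp [hu], Or.inr hvu.symm⟩
    · exact ⟨v, by simp [hv], Or.inl rfl⟩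

variable [DecidableEq V]

/-- The elimination process for the hypergraph of the edges of a forest. Its state consists of the
remaining vertices `Y` and the remaining edges `J`, which may have one end outside `Y`; the edges
removed so far are those at eliminated vertices `x`, each deepest in the set `Y` of its time. If the
process exhausts everything, the vertices `x` form a minimal cover `A` of the edges. Those among
them that were removed together with their parent form the packing `M`. -/
theorem IsDepth.hasOutcome_edges (hd : G.IsDepth d) :
    ∀ (Y : Finset V) (J : Set (Sym2 V)), J ⊆ G.edgeSet →
      (∀ u ∈ Y, ∀ v ∈ Y, G.Adj u v → s(u, v) ∈ J) →
      (∀ u, ∀ v ∈ Y, G.Adj u v → s(u, v) ∉ J → d v < d u) →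
      HasOutcome (fun (v : V) (e : Sym2 V) => v ∈ e) Y J none ∨
      ∃ A M : Finset V, A ⊆ Y ∧ M ⊆ Y ∧
        HasOutcome (fun (v : V) (e : Sym2 V) => v ∈ e) Y J (some A.card) ∧
        M.card + A.card = Y.card ∧ (∀ e ∈ J, ∃ a ∈ A, a ∈ e) ∧
        (∀ a ∈ A, ∃ u, s(a, u) ∈ J ∧ u ∉ A) ∧ (∀ v ∈ M, ∀ u, s(v, u) ∈ J → u ∈ Y) ∧
        G.IsPacking M := by
  intro Y
  induction Y using Finset.strongInduction with
  | H Y ih =>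
    intro J hJE hin hout
    rcases Y.eq_empty_or_nonempty with rfl | hne
    · rcases J.eq_empty_or_nonempty with rfl | hJ
      · exact Or.inr ⟨∅, ∅, subset_rfl, subset_rfl, ⟨rfl, rfl⟩, rfl, by simp, by simp, by simp,
          by simp [IsPacking]⟩
      · exact Or.inl (Or.inr ⟨rfl, hJ⟩)
    obtain ⟨x, hx, hmax⟩ := Y.exists_max_image d hne
    set J' : Set (Sym2 V) := {e ∈ J | x ∉ e} with hJ'
    have hJ'J : J' ⊆ J := fun e he => he.1
    have hin' : ∀ Y' ⊆ Y, x ∉ Y' → ∀ u ∈ Y', ∀ v ∈ Y', G.Adj u v → s(u, v) ∈ J' := by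
      intro Y' hY' hxY' u hu v hv huv
      refine ⟨hin u (hY' hu) v (hY' hv) huv, fun h => ?_⟩
      rcases Sym2.mem_iff.1 h with rfl | rfl
      · exact hxY' hu
      · exact hxY' hv
    have hout' : ∀ Y' ⊆ Y, x ∉ Y' → ∀ u, ∀ v ∈ Y', G.Adj u v → s(u, v) ∉ J' → d v < d u := by
      intro Y' hY' hxY' u v hv huv h
      by_cases huvJ : s(u, v) ∈ J
      · have hxe : x ∈ s(u, v) := by
          by_contra hc
          exact h ⟨huvJ, hc⟩
        rcases Sym2.mem_iff.1 hxe with rfl | rfl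
        · exact lt_of_le_of_ne (hmax v (hY' hv)) (hd.ne_of_adj huv).symm
        · exact absurd hv hxY'
      · exact hout u v (hY' hv) huv huvJ
    by_cases h1 : ∃ z, s(x, z) ∈ J ∧ z ∉ Y
    · -- the trace `{x}` of an edge is eliminated
      obtain ⟨z, hxz, hzY⟩ := h1
      have hxY' : x ∉ Y.erase x := Finset.notMem_erase x Y
      have hsub : Y.erase x ⊆ Y := Finset.erase_subset x Y
      have htr : ∀ y ∈ Y, y ∈ s(x, z) → y = x := by
        intro y hy hyz
        rcases Sym2.mem_iff.1 hyz with h | rfl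
        · exact h
        · exact absurd hy hzY
      have hstep : ∀ {o}, HasOutcome (fun (v : V) (e : Sym2 V) => v ∈ e) (Y.erase x) J' o →
          HasOutcome (fun (v : V) (e : Sym2 V) => v ∈ e) Y J (o.map Nat.succ) := by
        intro o h
        refine HasOutcome.step hx hxz (Sym2.mem_mk_left x z) ?_ ?_ (fun _ => Iff.rfl) h
        · intro i' _ hxi' y hy hyz
          rwa [htr y hy hyz]
        · intro y
          rw [Finset.mem_erase, and_comm]
          refine and_congr_right fun hy => not_congr ⟨?_, htr y hy⟩
          rintro rfl
          exact Sym2.mem_mk_left y z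
      rcases ih _ (Finset.erase_ssubset hx) J' (hJ'J.trans hJE) (hin' _ hsub hxY')
        (hout' _ hsub hxY') with h | ⟨A, M, hAY, hMY, ho, hcard, hcov, hmin, hM, hpack⟩
      · exact Or.inl (hstep h)
      have hxA : x ∉ A := fun h => hxY' (hAY h)
      refine Or.inr ⟨insert x A, M, Finset.insert_subset hx (hAY.trans hsub), hMY.trans hsub, ?_,
        ?_, ?_, ?_, ?_, hpack⟩
      · rw [Finset.card_insert_of_notMem hxA]
        exact hstep ho
      · rw [Finset.card_insert_of_notMem hxA, ← Finset.card_erase_add_one hx, ← hcard, add_assoc]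
      · intro e he
        by_cases hxe : x ∈ e
        · exact ⟨x, Finset.mem_insert_self _ _, hxe⟩
        · obtain ⟨a, ha, hae⟩ := hcov e ⟨he, hxe⟩
          exact ⟨a, Finset.mem_insert_of_mem ha, hae⟩
      · intro a ha
        rcases Finset.mem_insert.1 ha with rfl | ha
        · refine ⟨z, hxz, fun h => hzY ?_⟩
          exact Finset.insert_subset hx (hAY.trans hsub) h
        · obtain ⟨u, hu, huA⟩ := hmin a ha
          refine ⟨u, hu.1, fun h => ?_⟩
          rcases Finset.mem_insert.1 h with rfl | h
          · exact hu.2 (Sym2.mem_mk_right _ _)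
          · exact huA h
      · intro v hv u hvu
        by_cases hxe : x ∈ s(v, u)
        · rcases Sym2.mem_iff.1 hxe with rfl | rfl
          · exact absurd (hMY hv) hxY'
          · exact hx
        · exact hsub (hM v hv u ⟨hvu, hxe⟩)
    · push Not at h1
      by_cases h2 : ∃ p, s(x, p) ∈ J
      · -- the edge from `x` to its parent `p` is eliminated
        obtain ⟨p, hxp⟩ := h2
        have hadj : G.Adj x p := hJE hxp
        have hpY : p ∈ Y := h1 p hxp
        have hlt : ∀ q, s(x, q) ∈ J → d q < d x := fun q hq =>
          lt_of_le_of_ne (hmax q (h1 q hq)) (hd.ne_of_adj (hJE hq)).symm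
        have huniq : ∀ q, s(x, q) ∈ J → q = p := fun q hq =>
          hd.parent_unique (hJE hq) hadj (hlt q hq) (hlt p hxp)
        set Y' := (Y.erase x).erase p with hY'
        have hsub : Y' ⊆ Y := (Finset.erase_subset p _).trans (Finset.erase_subset x Y)
        have hxY' : x ∉ Y' := fun h => Finset.notMem_erase x Y (Finset.mem_of_mem_erase h)
        have hpY' : p ∉ Y' := Finset.notMem_erase p _
        have hcardY : Y'.card + 2 = Y.card := by
          have e1 := Finset.card_erase_add_one hx
          have e2 : Y'.card + 1 = _ :=
            Finset.card_erase_add_one (Finset.mem_erase.2 ⟨hadj.ne.symm, hpY⟩)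
          omega
        have hss : Y' ⊂ Y := ⟨hsub, fun h => hxY' (h hx)⟩
        have hstep : ∀ {o}, HasOutcome (fun (v : V) (e : Sym2 V) => v ∈ e) Y' J' o →
            HasOutcome (fun (v : V) (e : Sym2 V) => v ∈ e) Y J (o.map Nat.succ) := by
          intro o h
          refine HasOutcome.step hx hxp (Sym2.mem_mk_left x p) ?_ ?_ (fun _ => Iff.rfl) h
          · intro i' hi' hxi' y _ hyp
            obtain ⟨q, rfl⟩ := Sym2.mem_iff_exists.1 hxi'
            rwa [huniq q hi']
          · intro y
            rw [hY', Finset.mem_erase, Finset.mem_erase, Sym2.mem_iff]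
            tauto
        rcases ih _ hss J' (hJ'J.trans hJE) (hin' _ hsub hxY') (hout' _ hsub hxY')
          with h | ⟨A, M, hAY, hMY, ho, hcard, hcov, hmin, hM, hpack⟩
        · exact Or.inl (hstep h)
        have hxA : x ∉ A := fun h => hxY' (hAY h)
        have hxM : x ∉ M := fun h => hxY' (hMY h)
        refine Or.inr ⟨insert x A, insert x M, Finset.insert_subset hx (hAY.trans hsub),
          Finset.insert_subset hx (hMY.trans hsub), ?_, ?_, ?_, ?_, ?_, hpack.insert ?_⟩
        · rw [Finset.card_insert_of_notMem hxA]
          exact hstep ho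
        · rw [Finset.card_insert_of_notMem hxA, Finset.card_insert_of_notMem hxM]
          omega
        · intro e he
          by_cases hxe : x ∈ e
          · exact ⟨x, Finset.mem_insert_self _ _, hxe⟩
          · obtain ⟨a, ha, hae⟩ := hcov e ⟨he, hxe⟩
            exact ⟨a, Finset.mem_insert_of_mem ha, hae⟩
        · intro a ha
          rcases Finset.mem_insert.1 ha with rfl | ha
          · refine ⟨p, hxp, fun h => ?_⟩
            rcases Finset.mem_insert.1 h with h | h
            · exact hadj.ne h.symm
            · exact hpY' (hAY h)
          · obtain ⟨u, hu, huA⟩ := hmin a ha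
            refine ⟨u, hu.1, fun h => ?_⟩
            rcases Finset.mem_insert.1 h with rfl | h
            · exact hu.2 (Sym2.mem_mk_right _ _)
            · exact huA h
        · intro v hv u hvu
          rcases Finset.mem_insert.1 hv with rfl | hv
          · exact h1 u hvu
          · by_cases hxe : x ∈ s(v, u)
            · rcases Sym2.mem_iff.1 hxe with rfl | rfl
              · exact absurd (hMY hv) hxY'
              · exact hx
            · exact hsub (hM v hv u ⟨hvu, hxe⟩)
        · -- a vertex `w` of `M` is at distance at least three from `x`
          intro w hw u hux huw
          have hwY' := hMY hw
          have hwx : w ≠ x := fun h => hxY' (h ▸ hwY')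
          have hnadj : ¬ G.Adj x w := fun h =>
            hpY' (huniq w (hin x hx w (hsub hwY') h) ▸ hwY')
          rcases hux with rfl | hux <;> rcases huw with rfl | huw
          · exact hwx rfl
          · exact hnadj huw
          · exact hnadj hux.symm
          by_cases hJux : s(u, x) ∈ J
          · -- here `u = p`, and the edge `{w, p}` has lost its end `p`
            obtain rfl := huniq u (Sym2.eq_swap ▸ hJux)
            refine hpY' (hM w hw u ⟨hin w (hsub hwY') u hpY huw.symm, fun h => ?_⟩)
            rcases Sym2.mem_iff.1 h with h | h
            · exact hwx h.symm
            · exact hux.ne h.symm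
          · -- here `u` is a child of `x`, so that `w` would be too deep
            have hxu := hout u x hx hux hJux
            have hwu := (hmax w (hsub hwY')).trans_lt hxu
            exact hwx (hd.parent_unique huw hux hwu hxu)
      · left
        push Not at h2
        refine HasOutcome.none_of_forall hx fun i hi hxi => ?_
        obtain ⟨q, rfl⟩ := Sym2.mem_iff_exists.1 hxi
        exact absurd hi (h2 q)

/-- The elimination process for the hypergraph of the stars of a forest, whose points are edges.
Its state consists of the remaining edges `Y` and the remaining vertices `J`; each step treats an
edge `{x, p}` with deepest lower end `x`, eliminating the star of `x` if `x` remains, and else the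
star of the parent `p`. If the process exhausts everything, the centres of the eliminated stars form
a minimal cover `C` of the edges. The centres `x` removed together with their parents form the
packing `M`. -/
theorem IsDepth.hasOutcome_stars (hd : G.IsDepth d) :
    ∀ (Y : Finset (Sym2 V)) (J : Finset V), (∀ e ∈ Y, e ∈ G.edgeSet) →
      (∀ u ∈ J, ∀ v ∈ J, G.Adj u v → s(u, v) ∈ Y) →
      HasOutcome (fun (e : Sym2 V) (v : V) => v ∈ e) Y (J : Set V) none ∨
      ∃ C M : Finset V, C ⊆ J ∧ M ⊆ J ∧
        HasOutcome (fun (e : Sym2 V) (v : V) => v ∈ e) Y (J : Set V) (some C.card) ∧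
        M.card + C.card = J.card ∧ (∀ e ∈ Y, ∃ c ∈ C, c ∈ e) ∧
        (∀ c ∈ C, ∃ u, s(c, u) ∈ Y ∧ u ∉ C) ∧ (∀ v ∈ M, ∀ u, s(v, u) ∈ Y → u ∈ J) ∧
        (∀ v ∈ M, ∃ q, s(v, q) ∈ Y) ∧ G.IsPacking M := by
  intro Y
  induction Y using Finset.strongInduction with
  | H Y ih =>
    intro J hYE hin
    rcases Y.eq_empty_or_nonempty with rfl | hne
    · rcases J.eq_empty_or_nonempty with rfl | hJ
      · exact Or.inr ⟨∅, ∅, subset_rfl, subset_rfl, ⟨rfl, Finset.coe_empty⟩, rfl, by simp, by simp,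
          by simp, by simp, by simp [IsPacking]⟩
      · exact Or.inl (Or.inr ⟨rfl, Finset.coe_nonempty.2 hJ⟩)
    obtain ⟨x, p, hxp, hadj, hlt, huniq, hmax⟩ := hd.exists_deepest_edge hYE hne
    have hpx : p ≠ x := hadj.ne.symm
    by_cases hxJ : x ∈ J
    · -- the star of `x` has been reduced to the edge `{x, p}`
      set Y' := Y.filter (fun e => x ∉ e) with hY'
      set J' := (J.erase x).erase p with hJ'
      have hmemY' : ∀ e, e ∈ Y' ↔ e ∈ Y ∧ x ∉ e := fun e => Finset.mem_filter
      have hmemJ' : ∀ v, v ∈ J' ↔ v ≠ p ∧ v ≠ x ∧ v ∈ J := fun v => by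
        rw [hJ', Finset.mem_erase, Finset.mem_erase]
      have hss : Y' ⊂ Y := Finset.filter_ssubset.2 ⟨_, hxp, fun h => h (Sym2.mem_mk_left x p)⟩
      have hsubJ : J' ⊆ J := fun v hv => ((hmemJ' v).1 hv).2.2
      have hin' : ∀ u ∈ J', ∀ v ∈ J', G.Adj u v → s(u, v) ∈ Y' := by
        intro u hu v hv huv
        refine (hmemY' _).2 ⟨hin u (hsubJ hu) v (hsubJ hv) huv, fun h => ?_⟩
        rcases Sym2.mem_iff.1 h with rfl | rfl
        · exact ((hmemJ' _).1 hu).2.1 rfl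
        · exact ((hmemJ' _).1 hv).2.1 rfl
      have hstep : ∀ {o}, HasOutcome (fun (e : Sym2 V) (v : V) => v ∈ e) Y' (J' : Set V) o →
          HasOutcome (fun (e : Sym2 V) (v : V) => v ∈ e) Y (J : Set V) (o.map Nat.succ) := by
        intro o h
        refine HasOutcome.step hxp (Finset.mem_coe.2 hxJ) (Sym2.mem_mk_left x p) ?_ hmemY' ?_ h
        · intro i' _ hi' f hf hxf
          obtain ⟨q, rfl⟩ := Sym2.mem_iff_exists.1 hxf
          rwa [huniq q hf]
        · intro v
          rw [Finset.mem_coe, hmemJ', Finset.mem_coe, Sym2.mem_iff]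
          tauto
      rcases ih Y' hss J' (fun e he => hYE e (hss.subset he)) hin' with
        h | ⟨C, M, hCJ, hMJ, ho, hcard, hcov, hmin, hM, hpar, hpack⟩
      · exact Or.inl (hstep h)
      have hxC : x ∉ C := fun h => ((hmemJ' x).1 (hCJ h)).2.1 rfl
      have hpC : p ∉ C := fun h => ((hmemJ' p).1 (hCJ h)).1 rfl
      have hxM : x ∉ M := fun h => ((hmemJ' x).1 (hMJ h)).2.1 rfl
      have hCJ' : insert x C ⊆ J := Finset.insert_subset hxJ (hCJ.trans hsubJ)
      have ho' : HasOutcome (fun (e : Sym2 V) (v : V) => v ∈ e) Y (J : Set V)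
          (some (insert x C).card) := by
        rw [Finset.card_insert_of_notMem hxC]
        exact hstep ho
      have hcov' : ∀ e ∈ Y, ∃ c ∈ insert x C, c ∈ e := by
        intro e he
        by_cases hxe : x ∈ e
        · exact ⟨x, Finset.mem_insert_self _ _, hxe⟩
        · obtain ⟨c, hc, hce⟩ := hcov e ((hmemY' e).2 ⟨he, hxe⟩)
          exact ⟨c, Finset.mem_insert_of_mem hc, hce⟩
      have hmin' : ∀ c ∈ insert x C, ∃ u, s(c, u) ∈ Y ∧ u ∉ insert x C := by
        intro c hc
        rcases Finset.mem_insert.1 hc with rfl | hc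
        · exact ⟨p, hxp, by simp [hpx, hpC]⟩
        · obtain ⟨u, hu, huC⟩ := hmin c hc
          rw [hmemY'] at hu
          refine ⟨u, hu.1, fun h => ?_⟩
          rcases Finset.mem_insert.1 h with rfl | h
          · exact hu.2 (Sym2.mem_mk_right _ _)
          · exact huC h
      have hM' : ∀ v ∈ M, ∀ u, s(v, u) ∈ Y → u ∈ J := by
        intro v hv u hvu
        have hvJ := (hmemJ' v).1 (hMJ hv)
        refine hsubJ (hM v hv u ((hmemY' _).2 ⟨hvu, fun h => ?_⟩))
        rcases Sym2.mem_iff.1 h with rfl | rfl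
        · exact hvJ.2.1 rfl
        · exact hvJ.1 (huniq v (Sym2.eq_swap ▸ hvu))
      have hpar' : ∀ v ∈ M, ∃ q, s(v, q) ∈ Y := fun v hv =>
        (hpar v hv).imp fun q hq => hss.subset hq
      have e1 := Finset.card_erase_add_one hxJ
      by_cases hpJ : p ∈ J
      · refine Or.inr ⟨insert x C, insert x M, hCJ', Finset.insert_subset hxJ (hMJ.trans hsubJ),
          ho', ?_, hcov', hmin', ?_, ?_, hpack.insert ?_⟩
        · have e2 : J'.card + 1 = _ :=
            Finset.card_erase_add_one (Finset.mem_erase.2 ⟨hpx, hpJ⟩)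
          rw [Finset.card_insert_of_notMem hxC, Finset.card_insert_of_notMem hxM]
          omega
        · intro v hv u hvu
          rcases Finset.mem_insert.1 hv with rfl | hv
          · rwa [huniq u hvu]
          · exact hM' v hv u hvu
        · intro v hv
          rcases Finset.mem_insert.1 hv with rfl | hv
          · exact ⟨p, hxp⟩
          · exact hpar' v hv
        · -- a vertex `w` of `M` is at distance at least three from `x`
          intro w hw u hux huw
          obtain ⟨hwp, hwx, hwJ⟩ := (hmemJ' w).1 (hMJ hw)
          have hnadj : ¬ G.Adj x w := fun h => hwp (huniq w (hin x hxJ w hwJ h))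
          rcases hux with rfl | hux <;> rcases huw with rfl | huw
          · exact hwx rfl
          · exact hnadj huw
          · exact hnadj hux.symm
          by_cases hup : u = p
          · -- the edge `{w, p}` remains although the vertex `p` does not
            subst hup
            have hwu : s(w, u) ∈ Y' := by
              refine (hmemY' _).2 ⟨hin w hwJ u hpJ huw.symm, fun h => ?_⟩
              rcases Sym2.mem_iff.1 h with h | h
              · exact hwx h.symm
              · exact hux.ne h.symm
            exact ((hmemJ' u).1 (hM w hw u hwu)).1 rfl
          · -- here `u` is a child of `x`, so that `w` would be too deep
            have hxu : d x < d u := by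
              refine lt_of_le_of_ne (not_lt.1 fun h => hup ?_) (hd.ne_of_adj hux).symm
              exact hd.parent_unique hux.symm hadj h hlt
            obtain ⟨q, hq⟩ := hpar' w hw
            exact hwx (hd.parent_unique huw hux ((hmax w q hq).trans_lt hxu) hxu)
      · refine Or.inr ⟨insert x C, M, hCJ', hMJ.trans hsubJ, ho', ?_, hcov', hmin', hM', hpar',
          hpack⟩
        have e2 : J' = J.erase x :=
          Finset.erase_eq_of_notMem fun h => hpJ (Finset.mem_of_mem_erase h)
        rw [Finset.card_insert_of_notMem hxC]
        rw [e2] at hcard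
        omega
    by_cases hpJ : p ∈ J
    · -- only the star of `p` contains the edge `{x, p}`
      set Y' := Y.filter (fun e => p ∉ e) with hY'
      have hmemY' : ∀ e, e ∈ Y' ↔ e ∈ Y ∧ p ∉ e := fun e => Finset.mem_filter
      have hss : Y' ⊂ Y := Finset.filter_ssubset.2 ⟨_, hxp, fun h => h (Sym2.mem_mk_right x p)⟩
      have hsubJ : J.erase p ⊆ J := Finset.erase_subset p J
      have hin' : ∀ u ∈ J.erase p, ∀ v ∈ J.erase p, G.Adj u v → s(u, v) ∈ Y' := by
        intro u hu v hv huv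
        refine (hmemY' _).2 ⟨hin u (hsubJ hu) v (hsubJ hv) huv, fun h => ?_⟩
        rcases Sym2.mem_iff.1 h with rfl | rfl
        · exact Finset.ne_of_mem_erase hu rfl
        · exact Finset.ne_of_mem_erase hv rfl
      have hstep : ∀ {o}, HasOutcome (fun (e : Sym2 V) (v : V) => v ∈ e) Y'
          ((J.erase p : Finset V) : Set V) o →
          HasOutcome (fun (e : Sym2 V) (v : V) => v ∈ e) Y (J : Set V) (o.map Nat.succ) := by
        intro o h
        have hJp : ∀ v ∈ J, v ∈ s(x, p) → v = p := by
          intro v hv hvp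
          rcases Sym2.mem_iff.1 hvp with rfl | h
          · exact absurd hv hxJ
          · exact h
        refine HasOutcome.step hxp (Finset.mem_coe.2 hpJ) (Sym2.mem_mk_right x p) ?_ hmemY' ?_ h
        · intro i' hi' hi'p f _ hpf
          rwa [hJp i' hi' hi'p]
        · intro v
          rw [Finset.mem_coe, Finset.mem_erase, and_comm, Finset.mem_coe]
          refine and_congr_right fun hv => not_congr ⟨?_, hJp v hv⟩
          rintro rfl
          exact Sym2.mem_mk_right x v
      rcases ih Y' hss (J.erase p) (fun e he => hYE e (hss.subset he)) hin' with
        h | ⟨C, M, hCJ, hMJ, ho, hcard, hcov, hmin, hM, hpar, hpack⟩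
      · exact Or.inl (hstep h)
      have hpC : p ∉ C := fun h => Finset.notMem_erase p J (hCJ h)
      have hCJ' : insert p C ⊆ J := Finset.insert_subset hpJ (hCJ.trans hsubJ)
      refine Or.inr ⟨insert p C, M, hCJ', hMJ.trans hsubJ, ?_, ?_, ?_, ?_, ?_, ?_, hpack⟩
      · rw [Finset.card_insert_of_notMem hpC]
        exact hstep ho
      · rw [Finset.card_insert_of_notMem hpC, ← Finset.card_erase_add_one hpJ, ← hcard, add_assoc]
      · intro e he
        by_cases hpe : p ∈ e
        · exact ⟨p, Finset.mem_insert_self _ _, hpe⟩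
        · obtain ⟨c, hc, hce⟩ := hcov e ((hmemY' e).2 ⟨he, hpe⟩)
          exact ⟨c, Finset.mem_insert_of_mem hc, hce⟩
      · intro c hc
        rcases Finset.mem_insert.1 hc with rfl | hc
        · exact ⟨x, Sym2.eq_swap ▸ hxp, fun h => hxJ (hCJ' h)⟩
        · obtain ⟨u, hu, huC⟩ := hmin c hc
          rw [hmemY'] at hu
          refine ⟨u, hu.1, fun h => ?_⟩
          rcases Finset.mem_insert.1 h with rfl | h
          · exact hu.2 (Sym2.mem_mk_right _ _)
          · exact huC h
      · intro v hv u hvu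
        by_cases hpe : p ∈ s(v, u)
        · rcases Sym2.mem_iff.1 hpe with rfl | rfl
          · exact absurd (hMJ hv) (Finset.notMem_erase _ J)
          · exact hpJ
        · exact hsubJ (hM v hv u ((hmemY' _).2 ⟨hvu, hpe⟩))
      · exact fun v hv => (hpar v hv).imp fun q hq => hss.subset hq
    · left
      refine HasOutcome.none_of_forall hxp fun i hi hxi => ?_
      rcases Sym2.mem_iff.1 hxi with rfl | rfl
      · exact absurd hi hxJ
      · exact absurd hi hpJ

/-! ### The four Alexander duals as complexes of non-transversals -/

variable [Fintype V] (G) [DecidableRel G.Adj]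

theorem indepComplex_alexanderDual : G.indepComplex.alexanderDual =
    nonTransversal (fun (v : V) (e : Sym2 V) => v ∈ e) Finset.univ G.edgeSet := by
  refine ext_faces rfl fun F => ?_
  simp only [alexanderDual, indepComplex, Finset.mem_filter, Finset.mem_powerset,
    mem_nonTransversal, Finset.mem_univ, true_and]
  refine and_congr_right fun _ => ?_
  constructor
  · intro h
    by_contra! hc
    refine h fun u hu v hv _ huv => ?_
    simp only [Finset.coe_sdiff, Finset.coe_univ, Set.mem_sdiff, Set.mem_univ, true_and,
      Finset.mem_coe] at hu hv
    obtain ⟨y, hy, hye⟩ := hc s(u, v) huv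
    rcases Sym2.mem_iff.1 hye with rfl | rfl
    · exact hu hy
    · exact hv hy
  · rintro ⟨e, he, hF⟩ h
    induction e with
    | h u v =>
      have huv : G.Adj u v := he
      refine h (x := u) ?_ (y := v) ?_ huv.ne huv
      · simpa using fun hu => hF u hu (Sym2.mem_mk_left u v)
      · simpa using fun hv => hF v hv (Sym2.mem_mk_right u v)

theorem dominanceComplex_alexanderDual : G.dominanceComplex.alexanderDual =
    nonTransversal (fun u v => u = v ∨ G.Adj u v) Finset.univ ((Finset.univ : Finset V) : Set V) := by
  refine ext_faces rfl fun F => ?_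
  simp only [alexanderDual, dominanceComplex, Finset.mem_filter, Finset.mem_powerset,
    mem_nonTransversal, Finset.mem_univ, true_and, IsDominatingSet, Finset.mem_sdiff, not_not]
  push Not
  simp

theorem edgeCoverComplex_alexanderDual : G.edgeCoverComplex.alexanderDual =
    nonTransversal (fun (e : Sym2 V) (v : V) => v ∈ e) G.edgeFinset
      ((Finset.univ : Finset V) : Set V) := by
  refine ext_faces rfl fun F => ?_
  simp only [alexanderDual, edgeCoverComplex, Finset.mem_filter, Finset.mem_powerset,
    mem_nonTransversal, Finset.sdiff_subset, true_and]
  refine and_congr_right fun hF => ?_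
  rw [Finset.sdiff_sdiff_eq_self hF]
  push Not
  simp

theorem edgeDominanceComplex_alexanderDual : G.edgeDominanceComplex.alexanderDual =
    nonTransversal (fun e f : Sym2 V => ∃ v, v ∈ e ∧ v ∈ f) G.edgeFinset
      (G.edgeFinset : Set (Sym2 V)) := by
  refine ext_faces rfl fun F => ?_
  simp only [alexanderDual, edgeDominanceComplex, Finset.mem_filter, Finset.mem_powerset,
    mem_nonTransversal, Finset.sdiff_subset, true_and]
  refine and_congr_right fun hF => ?_
  rw [Finset.sdiff_sdiff_eq_self hF]
  push Not
  simp

end SimpleGraph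

open FinComplex SimpleGraph in
/-- A contractible outcome excludes cross-polytope boundaries, and a spherical one comes with the
values of the domination numbers. -/
theorem FinComplex.HasOutcome.equiv_or {V α ι : Type*} [Fintype V] {G : SimpleGraph V} [Finite α]
    [DecidableEq α] {R : α → ι → Prop} {Y : Finset α} {J : Set ι} (hY : Y.Nonempty)
    (h : HasOutcome R Y J none ∨ ∃ k, HasOutcome R Y J (some k) ∧
      k + G.indepDominationNum = Fintype.card V ∧ G.indepDominationNum = G.dominationNum) :
    ((nonTransversal R Y J).SimpleHomotopyEquiv (void (∅ : Finset ℕ)) ∨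
      ∃ n : ℕ, n + G.indepDominationNum + 1 = Fintype.card V ∧
        (nonTransversal R Y J).SimpleHomotopyEquiv (crossPolytopeBoundary n)) ∧
    (∀ n : ℕ, (nonTransversal R Y J).SimpleHomotopyEquiv (crossPolytopeBoundary n) →
      G.indepDominationNum = G.dominationNum) := by
  rcases h with (h | h) | ⟨k, h, hk, hdom⟩
  · exact ⟨Or.inl h.2.equiv_void, fun n hn => absurd hn (h.2.not_equiv_crossPolytopeBoundary n)⟩
  · exact absurd h.1 hY.ne_empty
  · match k, h with
    | 0, h => exact absurd h.1 hY.ne_empty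
    | n + 1, h =>
      exact ⟨Or.inr ⟨n, by omega, h.2.equiv_crossPolytopeBoundary⟩, fun _ _ => hdom⟩

open FinComplex SimpleGraph in
theorem corollary6p6 {V : Type*} [Fintype V] [DecidableEq V] (G : SimpleGraph V)
    [DecidableRel G.Adj] (hG : G.IsAcyclic) :
    -- all four Alexander duals are strong combinatorial grapes
    (G.indepComplex.alexanderDual.IsStrongGrape ∧
      G.dominanceComplex.alexanderDual.IsStrongGrape ∧
      G.edgeCoverComplex.alexanderDual.IsStrongGrape ∧
      G.edgeDominanceComplex.alexanderDual.IsStrongGrape) ∧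
    -- the dual of the independence complex
    ((G.indepComplex.alexanderDual.SimpleHomotopyEquiv (FinComplex.void (∅ : Finset ℕ)) ∨
        ∃ n : ℕ, n + G.indepDominationNum + 1 = Fintype.card V ∧
          G.indepComplex.alexanderDual.SimpleHomotopyEquiv
            (FinComplex.crossPolytopeBoundary n)) ∧
      (∀ n : ℕ, G.indepComplex.alexanderDual.SimpleHomotopyEquiv
          (FinComplex.crossPolytopeBoundary n) →
        G.indepDominationNum = G.dominationNum)) ∧
    -- the dual of the dominance complex
    (Nonempty V →
      ∃ n : ℕ, (n : ℕ∞) + G.vertexCoverNum + 1 = (Fintype.card V : ℕ∞) ∧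
        G.dominanceComplex.alexanderDual.SimpleHomotopyEquiv
          (FinComplex.crossPolytopeBoundary n)) ∧
    -- the dual of the edge covering complex
    (G.edgeSet.Nonempty →
      (G.edgeCoverComplex.alexanderDual.SimpleHomotopyEquiv (FinComplex.void (∅ : Finset ℕ)) ∨
        ∃ n : ℕ, n + G.indepDominationNum + 1 = Fintype.card V ∧
          G.edgeCoverComplex.alexanderDual.SimpleHomotopyEquiv
            (FinComplex.crossPolytopeBoundary n)) ∧
      (∀ n : ℕ, G.edgeCoverComplex.alexanderDual.SimpleHomotopyEquiv
          (FinComplex.crossPolytopeBoundary n) →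
        G.indepDominationNum = G.dominationNum)) ∧
    -- the dual of the edge dominance complex
    (G.edgeSet.Nonempty →
      ∃ n : ℕ, (n : ℕ∞) + 1 = G.vertexCoverNum ∧
        G.edgeDominanceComplex.alexanderDual.SimpleHomotopyEquiv
          (FinComplex.crossPolytopeBoundary n)) := by
  classical
  obtain ⟨d, hd⟩ := hG.exists_isDepth
  have hI := hd.hasOutcome_edges Finset.univ G.edgeSet subset_rfl (fun u _ v _ h => h)
    (fun u v _ h h' => absurd h h')
  replace hI : HasOutcome (fun (v : V) (e : Sym2 V) => v ∈ e) Finset.univ G.edgeSet none ∨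
      ∃ k, HasOutcome (fun (v : V) (e : Sym2 V) => v ∈ e) Finset.univ G.edgeSet (some k) ∧
        k + G.indepDominationNum = Fintype.card V ∧
          G.indepDominationNum = G.dominationNum := by
    refine hI.imp_right ?_
    rintro ⟨A, M, -, -, ho, hcard, hcov, hmin, -, hpack⟩
    refine ⟨A.card, ho, hpack.domination_eq_of_cover hcard (fun u v huv => ?_) hmin⟩
    obtain ⟨a, ha, hae⟩ := hcov s(u, v) huv
    rcases Sym2.mem_iff.1 hae with rfl | rfl
    · exact Or.inl ha
    · exact Or.inr ha
  have hC := hd.hasOutcome_stars G.edgeFinset Finset.univ (fun e he => mem_edgeFinset.1 he)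
    (fun u _ v _ h => mem_edgeFinset.2 h)
  replace hC : HasOutcome (fun (e : Sym2 V) (v : V) => v ∈ e) G.edgeFinset
        ((Finset.univ : Finset V) : Set V) none ∨
      ∃ k, HasOutcome (fun (e : Sym2 V) (v : V) => v ∈ e) G.edgeFinset
          ((Finset.univ : Finset V) : Set V) (some k) ∧
        k + G.indepDominationNum = Fintype.card V ∧
          G.indepDominationNum = G.dominationNum := by
    refine hC.imp_right ?_
    rintro ⟨A, M, -, -, ho, hcard, hcov, hmin, -, -, hpack⟩
    refine ⟨A.card, ho, hpack.domination_eq_of_cover hcard (fun u v huv => ?_) fun a ha => ?_⟩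
    · obtain ⟨a, ha, hae⟩ := hcov s(u, v) (mem_edgeFinset.2 huv)
      rcases Sym2.mem_iff.1 hae with rfl | rfl
      · exact Or.inl ha
      · exact Or.inr ha
    · obtain ⟨u, hu, huA⟩ := hmin a ha
      exact ⟨u, mem_edgeFinset.1 hu, huA⟩
  obtain ⟨k, hk, hD⟩ := hd.exists_hasOutcome_dominance
  obtain ⟨l, hl, hED⟩ := hd.exists_hasOutcome_edgeDominance
  rw [indepComplex_alexanderDual, dominanceComplex_alexanderDual, edgeCoverComplex_alexanderDual,
    edgeDominanceComplex_alexanderDual]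
  have hE : G.edgeSet.Nonempty → G.edgeFinset.Nonempty := fun h => by
    rwa [← coe_edgeFinset, Finset.coe_nonempty] at h
  refine ⟨⟨?_, hD.isStrongGrape, ?_, hED.isStrongGrape⟩, ?_, fun hV => ?_, fun hne =>
    HasOutcome.equiv_or (hE hne) hC, fun hne => ?_⟩
  · rcases hI with h | ⟨_, h, -⟩ <;> exact h.isStrongGrape
  · rcases hC with h | ⟨_, h, -⟩ <;> exact h.isStrongGrape
  · rcases isEmpty_or_nonempty V with hV | hV
    · -- without vertices the complex is void on the empty set of points, a case without an apex
      have hf : (nonTransversal (fun (v : V) (e : Sym2 V) => v ∈ e) Finset.univ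
          G.edgeSet).faces = ∅ := by
        refine Finset.eq_empty_of_forall_notMem fun F hF => ?_
        obtain ⟨-, e, -, -⟩ := mem_nonTransversal.1 hF
        induction e with
        | h u v => exact hV.elim u
      refine ⟨Or.inl ⟨fun v => hV.elim v, id, fun v => hV.elim v, Function.injective_id.injOn, ?_⟩,
        fun n _ => ?_⟩
      · rw [hf]
        exact Relation.EqvGen.refl _
      · rcases hI with (h | h) | ⟨_, -, -, h⟩
        · exact hV.elim h.1.choose
        · obtain ⟨e, -⟩ := h.2
          induction e with
          | h u v => exact hV.elim u
        · exact h
    · exact HasOutcome.equiv_or Finset.univ_nonempty hI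
  · match k, hD with
    | 0, h => exact absurd h.1 Finset.univ_nonempty.ne_empty
    | n + 1, h =>
      refine ⟨n, ?_, h.2.equiv_crossPolytopeBoundary⟩
      rw [← hk]
      push_cast
      ring
  · match l, hED with
    | 0, h => exact absurd h.1 (hE hne).ne_empty
    | n + 1, h => exact ⟨n, by rw [← hl]; push_cast; ring, h.2.equiv_crossPolytopeBoundary⟩
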